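/- For positive integers $n,m$ and a function $f:[n]\to[m]$, let $\mathcal P_f$ be the distribution on $[m]$ with $\mathcal P_f(j)=|f^{-1}(j)|/n$, and let $U$ be the uniform distribution on $[m]$. Quantum access to $f$ is by the oracle unitary $O_f:|x\rangle|b\rangle\mapsto|x\rangle|b\oplus f(x)\rangle$, where $x\in[n]$, $b$ is a string of $\lceil\log_2 m\rceil$ bits, $f(x)$ is written in binary and $\oplus$ is bitwise addition modulo $2$. A $T$-query quantum algorithm starts in a fixed basis state, alternates unitaries that do not depend on $f$ with $T$ applications of $O_f$ (the workspace being an arbitrary finite-dimensional register), and measures the final state in the computational basis to produce an output. Theorem. There is an absolute constant $C>0$ such that for all positive integers $n,m$ and every real $\varepsilon>0$ there is a quantum query algorithm with outputs ACCEPT and REJECT, depending only on $n,m,\varepsilon$, that makes at most $C\,m^{1/3}/\varepsilon^{2}$ queries and satisfies, for every $f:[n]\to[m]$: - if $\|\mathcal P_f-U\|_1=\sum_{j=1}^m|\mathcal P_f(j)-1/m|\ge\varepsilon$, then the algorithm outputs REJECT with probability at least $2/3$; - if $\|\mathcal P_f-U\|_\infty=\max_{j\in[m]}|\mathcal P_f(j)-1/m|\le\varepsilon/(4m)$,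 then the algorithm outputs ACCEPT with probability at least $2/3$. -/

import Mathlib

/-- The distribution `P_f` on `[m]` defined by `f : [n] → [m]`: `P_f(j) = |f⁻¹(j)| / n`. -/
noncomputable def funDist {n m : ℕ} (f : Fin n → Fin m) (j : Fin m) : ℝ :=
  ((Finset.univ.filter fun i => f i = j).card : ℝ) / (n : ℝ)

/-- The uniform distribution on `[m]`. -/
noncomputable def unifDist (m : ℕ) (_j : Fin m) : ℝ := 1 / (m : ℝ)

/-- The `L₁`-distance of two weight functions on `[m]`. -/
noncomputable def l1Dist {m : ℕ} (P Q : Fin m → ℝ) : ℝ := ∑ j, |P j - Q j|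

/-- The `L_∞`-distance of two weight functions on `[m]` (the norm on `Fin m → ℝ` is the
maximum norm). -/
noncomputable def linftyDist {m : ℕ} (P Q : Fin m → ℝ) : ℝ := ‖P - Q‖

/-- The two possible outputs of a tester. -/
inductive Verdict where
  | accept
  | reject
  deriving DecidableEq

/-- The answer register of the oracle: strings of `⌈log₂ m⌉` bits. -/
abbrev AnswerReg (m : ℕ) : Type := Fin (Nat.clog 2 m) → Bool

/-- The binary encoding of an element of `[m]` as a string of `⌈log₂ m⌉` bits. -/
def encodeBits {m : ℕ} (y : Fin m) : AnswerReg m := fun k => (y : ℕ).testBit k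

/-- The encoding loses no information. -/
theorem encodeBits_injective {m : ℕ} : Function.Injective (encodeBits (m := m)) := by
  intro y z h
  apply Fin.ext
  apply Nat.eq_of_testBit_eq
  intro i
  by_cases hi : i < Nat.clog 2 m
  · exact congrFun h ⟨i, hi⟩
  · have key : ∀ u : Fin m, (u : ℕ).testBit i = false := fun u =>
      Nat.testBit_lt_two_pow (lt_of_lt_of_le u.2
        ((Nat.le_pow_clog (by norm_num) m).trans
          (Nat.pow_le_pow_right (by norm_num) (not_lt.mp hi))))
    rw [key y, key z]

/-- Computational basis of the joint system: query register, answer register, workspace. -/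
abbrev BasisState (n m : ℕ) (W : Type) : Type := Fin n × AnswerReg m × W

/-- The oracle on basis states: `(x, b, w) ↦ (x, b ⊕ f(x), w)`, with bitwise addition mod 2. -/
def oracleShift {n m : ℕ} {W : Type} (f : Fin n → Fin m) (s : BasisState n m W) :
    BasisState n m W :=
  (s.1, (fun k => xor (s.2.1 k) (encodeBits (f s.1) k)), s.2.2)

/-- The oracle unitary `O_f`, the linear extension of `|x⟩|b⟩|w⟩ ↦ |x⟩|b ⊕ f(x)⟩|w⟩`.
As the map on basis states is an involution, `O_f ψ` has coordinates `ψ(x, b ⊕ f(x), w)`. -/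
def oracle {n m : ℕ} {W : Type} (f : Fin n → Fin m) (ψ : BasisState n m W → ℂ) :
    BasisState n m W → ℂ :=
  fun s => ψ (oracleShift f s)

theorem oracleShift_involutive {n m : ℕ} {W : Type} (f : Fin n → Fin m) :
    Function.Involutive (oracleShift (W := W) f) := by
  rintro ⟨x, b, w⟩
  simp [oracleShift]

/-- `O_f` maps the basis vector `|x⟩|b⟩|w⟩` to `|x⟩|b ⊕ f(x)⟩|w⟩`. -/
theorem oracle_single {n m : ℕ} {W : Type} [DecidableEq W] (f : Fin n → Fin m)
    (s : BasisState n m W) :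
    oracle f (Pi.single s (1 : ℂ)) = Pi.single (oracleShift f s) 1 := by
  funext r
  simp only [oracle, Pi.single_apply]
  congr 1
  exact propext ⟨fun h => by rw [← h, oracleShift_involutive f r],
    fun h => by rw [h, oracleShift_involutive f s]⟩

/-- A quantum query algorithm for inputs `f : [n] → [m]`, in the standard model: it starts in a
basis state, alternates input-independent unitaries `U 0, U 1, …, U queries` with applications
of the oracle `O_f`, and finally measures in the computational basis and outputs a verdict that
depends on the outcome only. (Entries `U k` with `k > queries` are not used.) The workspace is
any finite-dimensional register; classical randomness and intermediate measurements are
implemented in it in the usual way. -/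
structure QueryAlgorithm (n m : ℕ) where
  /-- the number of applications of the oracle -/
  queries : ℕ
  /-- labels of the computational basis of the workspace -/
  Work : Type
  [fintypeWork : Fintype Work]
  [decEqWork : DecidableEq Work]
  init : BasisState n m Work
  U : ℕ → Matrix.unitaryGroup (BasisState n m Work) ℂ
  output : BasisState n m Work → Verdict

attribute [instance] QueryAlgorithm.fintypeWork QueryAlgorithm.decEqWork

/-- The state `U_k O_f U_{k-1} O_f ⋯ O_f U_0 |init⟩` after `k` queries to `f`. -/
noncomputable def QueryAlgorithm.state {n m : ℕ} (A : QueryAlgorithm n m) (f : Fin n → Fin m) :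
    ℕ → (BasisState n m A.Work → ℂ)
  | 0 => (A.U 0 : Matrix _ _ ℂ).mulVec (Pi.single A.init 1)
  | k + 1 => (A.U (k + 1) : Matrix _ _ ℂ).mulVec (oracle f (A.state f k))

/-- The probability that the algorithm, run with oracle `O_f`, outputs `v`. -/
noncomputable def QueryAlgorithm.outputProb {n m : ℕ} (A : QueryAlgorithm n m)
    (f : Fin n → Fin m) (v : Verdict) : ℝ :=
  ∑ s ∈ Finset.univ.filter (fun s => A.output s = v), ‖A.state f A.queries s‖ ^ 2

/-! Attach to every point and every value a label from `[R]`; this replaces `m` by `mR` values and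
leaves the relative density `u = m·P_f` unchanged. Pick a random set `S` of labelled points, each
independently with probability `p = 1 - exp(-s m/n)`, query it, and let `J` be the set of labelled
values seen. Fibres are disjoint, so the events `j ∈ J` are independent, and by the choice of `p`
the value `j` is missed with probability exactly `exp(-s u_j)`. With `v_j = u_j - 1` and `t = s m
R`, about `t` points are sampled.

The mass of `J` under the labelled distribution is `(|J| + ∑_{j∈J} v_j)/(mR)`. Since `∑ v_j = 0` and
heavier values are seen more often, `∑_{j∈J} v_j` has expectation about `s ∑ v_j²`. If `|v_j| ≤ ε/4`
everywhere, this sum stays below `6tε²/64`; if `P_f` is `ε`-far, it exceeds `10tε²/64`, with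
constant probability in both cases (`tail_upper`, `tail_lower`, from the moment bounds
`exp_moment_upper` and `exp_moment_lower`). The threshold `8tε²/64` leaves the margin `tε²/32` on
each side.

Amplitude estimation (`exists_amplitudeEstimation`) then compares the mass of `J` with the
threshold. Both are of order at most `s` and differ by at least `ε²s/32`, so their square roots
differ by order `ε²√s`, which `O(1/(ε²√s))` queries resolve. Taking `t` of order `m^{1/3}/ε²` and
`R` just large enough for `s ≤ 1/16` gives `√s` at least of order `m^{-1/3}`, hence the total
`O(m^{1/3}/ε²)`.

On the quantum side, algorithms are treated as functionals `φ ↦ E[φ(outcome)]` that can be composed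
(`Realizable.bind`); amplitude estimation is analysed through its mean squared error, using
summation by parts and Parseval. -/

/-! ### Norm-preserving maps and unitary matrices. -/

/-- The squared Euclidean norm of a vector of amplitudes. -/
noncomputable def stateNormSq {B : Type*} [Fintype B] (ψ : B → ℂ) : ℝ := ∑ s, ‖ψ s‖ ^ 2

/-- Linear maps that preserve the Euclidean norm. -/
def NormPreserving {B : Type*} [Fintype B] (L : (B → ℂ) →ₗ[ℂ] (B → ℂ)) : Prop :=
  ∀ ψ, stateNormSq (L ψ) = stateNormSq ψ

theorem stateNormSq_eq_norm {B : Type*} [Fintype B] (ψ : B → ℂ) :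
    stateNormSq ψ = ‖(WithLp.toLp 2 ψ : EuclideanSpace ℂ B)‖ ^ 2 := by
  rw [EuclideanSpace.norm_sq_eq]; rfl

theorem stateNormSq_single {B : Type*} [Fintype B] [DecidableEq B] (s : B) :
    stateNormSq (Pi.single s (1 : ℂ)) = 1 := by
  unfold stateNormSq
  rw [Finset.sum_eq_single s] <;> simp +contextual

theorem NormPreserving.id {B : Type*} [Fintype B] :
    NormPreserving (LinearMap.id : (B → ℂ) →ₗ[ℂ] (B → ℂ)) := fun _ => rfl

theorem NormPreserving.comp {B : Type*} [Fintype B] {L L' : (B → ℂ) →ₗ[ℂ] (B → ℂ)}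
    (h : NormPreserving L) (h' : NormPreserving L') : NormPreserving (L ∘ₗ L') := fun ψ => by
  rw [LinearMap.comp_apply, h, h']

theorem NormPreserving.funLeft {B : Type*} [Fintype B] (e : Equiv.Perm B) :
    NormPreserving (LinearMap.funLeft ℂ ℂ e) := fun ψ => by
  simpa [stateNormSq, LinearMap.funLeft_apply] using
    Equiv.sum_comp e (fun s => ‖ψ s‖ ^ 2)

/-- By polarization, preserving norms implies preserving inner products, and the entries of `U* U`
are inner products of images of basis vectors. Working with linear maps postpones matrices until the
final conversion in `Experiment.exists_queryAlgorithm`. -/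
theorem NormPreserving.exists_unitary {B : Type*} [Fintype B] [DecidableEq B]
    {L : (B → ℂ) →ₗ[ℂ] (B → ℂ)} (h : NormPreserving L) :
    ∃ U : Matrix.unitaryGroup B ℂ, ∀ ψ, (U : Matrix B B ℂ).mulVec ψ = L ψ := by
  let E := EuclideanSpace ℂ B
  let e : E ≃ₗ[ℂ] (B → ℂ) := WithLp.linearEquiv 2 ℂ (B → ℂ)
  let I : E →ₗᵢ[ℂ] E :=
    { toLinearMap := e.symm.toLinearMap ∘ₗ L ∘ₗ e.toLinearMap
      norm_map' := fun x => by
        have := h (e x)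
        rw [stateNormSq_eq_norm, stateNormSq_eq_norm] at this
        exact (sq_eq_sq₀ (norm_nonneg _) (norm_nonneg _)).mp this }
  refine ⟨⟨LinearMap.toMatrix' L, ?_⟩, fun ψ => ?_⟩
  · rw [Matrix.mem_unitaryGroup_iff']
    ext i j
    have := I.inner_map_map (EuclideanSpace.single i 1) (EuclideanSpace.single j 1)
    rw [EuclideanSpace.inner_single_left] at this
    rw [Matrix.mul_apply]
    have h2 : inner ℂ (I (EuclideanSpace.single i 1)) (I (EuclideanSpace.single j 1)) =
        ∑ k, inner ℂ (L (Pi.single i 1) k) (L (Pi.single j 1) k) := PiLp.inner_apply _ _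
    rw [h2] at this
    calc _ = ∑ k, inner ℂ (L (Pi.single i 1) k) (L (Pi.single j 1) k) :=
          Finset.sum_congr rfl fun k _ => by
            rw [Matrix.star_eq_conjTranspose, Matrix.conjTranspose_apply,
              LinearMap.toMatrix'_apply, LinearMap.toMatrix'_apply, RCLike.inner_apply, mul_comm]
            rfl
      _ = _ := by
        rw [this]
        simp [Matrix.one_apply]
  · simp [LinearMap.toMatrix'_mulVec]

/-- State preparation: extend `ψ` to an orthonormal basis in which it carries the index `s`, and map
the standard basis to it. -/
theorem exists_normPreserving_single {B : Type*} [Fintype B] [DecidableEq B] (s : B)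
    {ψ : B → ℂ} (hψ : stateNormSq ψ = 1) :
    ∃ L : (B → ℂ) →ₗ[ℂ] (B → ℂ), NormPreserving L ∧ L (Pi.single s 1) = ψ := by
  have hn : ‖(WithLp.toLp 2 ψ : EuclideanSpace ℂ B)‖ = 1 := by
    rw [stateNormSq_eq_norm] at hψ
    exact (pow_eq_one_iff_of_nonneg (norm_nonneg _) two_ne_zero).mp hψ
  obtain ⟨b, hb⟩ := Orthonormal.exists_orthonormalBasis_extension_of_card_eq
    (𝕜 := ℂ) (E := EuclideanSpace ℂ B) (ι := B) (by simp)
    (v := fun _ => WithLp.toLp 2 ψ) (s := {s}) (by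
      constructor
      · intro i; simpa using hn
      · intro i j hij; exact absurd (Subsingleton.elim i j) hij)
  let e : EuclideanSpace ℂ B ≃ₗ[ℂ] (B → ℂ) := WithLp.linearEquiv 2 ℂ (B → ℂ)
  refine ⟨e.toLinearMap ∘ₗ b.repr.symm.toLinearEquiv.toLinearMap ∘ₗ e.symm.toLinearMap, ?_, ?_⟩
  · intro φ
    rw [stateNormSq_eq_norm, stateNormSq_eq_norm]
    change ‖b.repr.symm (e.symm φ)‖ ^ 2 = ‖e.symm φ‖ ^ 2
    rw [LinearIsometryEquiv.norm_map]
  · change (b.repr.symm (EuclideanSpace.single s 1)).ofLp = ψ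
    rw [OrthonormalBasis.repr_symm_single, hb s rfl]

theorem stateNormSq_oracle {n m : ℕ} {W : Type} [Fintype W] (f : Fin n → Fin m)
    (ψ : BasisState n m W → ℂ) : stateNormSq (oracle f ψ) = stateNormSq ψ :=
  NormPreserving.funLeft (oracleShift_involutive f).toPerm ψ

/-! ### Algorithms with arbitrary outcomes and their expectations. -/

/-- The state after `k` queries, for an algorithm that starts in the basis state `i` and applies
`step k` after the `k`-th query. -/
noncomputable def runState {n m : ℕ} {W : Type} [DecidableEq W]
    (step : ℕ → (BasisState n m W → ℂ) →ₗ[ℂ] (BasisState n m W → ℂ)) (i : BasisState n m W)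
    (f : Fin n → Fin m) : ℕ → (BasisState n m W → ℂ)
  | 0 => step 0 (Pi.single i 1)
  | k + 1 => step (k + 1) (oracle f (runState step i f k))

/-- A query algorithm whose measurement outcome has values in an arbitrary type. -/
structure Experiment (n m : ℕ) (Ω : Type) where
  /-- the number of oracle calls -/
  queries : ℕ
  /-- labels of the computational basis of the workspace -/
  Work : Type
  [fintypeWork : Fintype Work]
  [decEqWork : DecidableEq Work]
  init : BasisState n m Work
  step : ℕ → (BasisState n m Work → ℂ) →ₗ[ℂ] (BasisState n m Work → ℂ)
  normPreserving_step : ∀ k, NormPreserving (step k)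
  outcome : BasisState n m Work → Ω

attribute [instance] Experiment.fintypeWork Experiment.decEqWork

namespace Experiment

variable {n m : ℕ} {Ω Ω' : Type}

/-- The state after `k` queries. -/
noncomputable def state (A : Experiment n m Ω) (f : Fin n → Fin m) (k : ℕ) :
    BasisState n m A.Work → ℂ :=
  runState A.step A.init f k

/-- The expectation of `φ` of the outcome. -/
noncomputable def expect (A : Experiment n m Ω) (f : Fin n → Fin m) (φ : Ω → ℝ) : ℝ :=
  ∑ s, ‖A.state f A.queries s‖ ^ 2 * φ (A.outcome s)

theorem stateNormSq_state (A : Experiment n m Ω) (f : Fin n → Fin m) (k : ℕ) :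
    stateNormSq (A.state f k) = 1 := by
  induction k with
  | zero => rw [state, runState, A.normPreserving_step, stateNormSq_single]
  | succ k ih => rw [state, runState, A.normPreserving_step, stateNormSq_oracle]; exact ih

theorem expect_const (A : Experiment n m Ω) (f : Fin n → Fin m) (c : ℝ) :
    A.expect f (fun _ => c) = c := by
  rw [expect, ← Finset.sum_mul]
  exact (congrArg (· * c) (A.stateNormSq_state f A.queries)).trans (one_mul c)

theorem expect_mono (A : Experiment n m Ω) (f : Fin n → Fin m) {φ φ' : Ω → ℝ}
    (h : ∀ ω, φ ω ≤ φ' ω) : A.expect f φ ≤ A.expect f φ' :=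
  Finset.sum_le_sum fun s _ => mul_le_mul_of_nonneg_left (h _) (by positivity)

theorem expect_const_sub_mul (A : Experiment n m Ω) (f : Fin n → Fin m) (a c : ℝ) (φ : Ω → ℝ) :
    A.expect f (fun ω => a - c * φ ω) = a - c * A.expect f φ := by
  have h := A.expect_const f a
  simp only [expect] at h ⊢
  conv_rhs => rw [← h]
  rw [Finset.mul_sum, ← Finset.sum_sub_distrib]
  exact Finset.sum_congr rfl fun s _ => by ring

/-- An experiment with two outcomes is a query algorithm in the standard model. -/
theorem exists_queryAlgorithm (A : Experiment n m Verdict) :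
    ∃ Q : QueryAlgorithm n m, Q.queries = A.queries ∧
      ∀ f v, Q.outputProb f v = A.expect f (fun w => if w = v then 1 else 0) := by
  choose U hU using fun k => (A.normPreserving_step k).exists_unitary
  let Q : QueryAlgorithm n m := ⟨A.queries, A.Work, A.init, U, A.outcome⟩
  refine ⟨Q, rfl, fun f v => ?_⟩
  have hs : ∀ k, Q.state f k = A.state f k := by
    intro k
    induction k with
    | zero => exact hU 0 _
    | succ k ih =>
      rw [QueryAlgorithm.state, ih]
      exact hU (k + 1) _
  simp only [QueryAlgorithm.outputProb, expect, hs]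
  rw [Finset.sum_filter]
  exact Finset.sum_congr rfl fun s _ => by simp only [mul_ite, mul_one, mul_zero]; rfl

end Experiment

/-! ### Elementary realizable expectations: randomness, constants, single queries. -/

/-- `E f φ` is the expectation of `φ` of the outcome of some algorithm with `T` queries to `f`. -/
def Realizable {n m : ℕ} {Ω : Type} (T : ℕ) (E : (Fin n → Fin m) → (Ω → ℝ) → ℝ) : Prop :=
  ∃ A : Experiment n m Ω, A.queries = T ∧ ∀ f φ, A.expect f φ = E f φ

/-- Classical randomness comes from measuring a superposition with amplitudes `√(p ω)` in the
workspace. -/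
theorem realizable_rand {n m : ℕ} (hn : 0 < n) {Ω : Type} [Fintype Ω] [DecidableEq Ω]
    (p : Ω → ℝ) (hp : ∀ ω, 0 ≤ p ω) (hp1 : ∑ ω, p ω = 1) :
    Realizable (n := n) (m := m) 0 (fun _ φ => ∑ ω, p ω * φ ω) := by
  obtain ⟨ω₀⟩ : Nonempty Ω := by
    by_contra h
    rw [not_nonempty_iff] at h
    simp at hp1
  let x₀ : Fin n := ⟨0, hn⟩
  let b₀ : AnswerReg m := fun _ => false
  let ψ : BasisState n m Ω → ℂ := fun s =>
    if s.1 = x₀ then if s.2.1 = b₀ then (Real.sqrt (p s.2.2) : ℂ) else 0 else 0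
  have hsum : ∀ φ : Ω → ℝ, ∑ s, ‖ψ s‖ ^ 2 * φ s.2.2 = ∑ ω, p ω * φ ω := by
    intro φ
    rw [Fintype.sum_prod_type, Finset.sum_eq_single x₀, Fintype.sum_prod_type,
      Finset.sum_eq_single b₀]
    · refine Finset.sum_congr rfl fun ω _ => ?_
      simp [ψ, Real.sq_sqrt (hp ω)]
    · intro b _ hb
      simp [ψ, hb]
    · simp
    · intro x _ hx
      simp [ψ, hx]
    · simp
  obtain ⟨L, hL, hLs⟩ := exists_normPreserving_single ((x₀, b₀, ω₀) : BasisState n m Ω) (ψ := ψ)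
    (by simpa [stateNormSq, hp1] using hsum (fun _ => 1))
  refine ⟨⟨0, Ω, (x₀, b₀, ω₀), fun _ => L, fun _ => hL, fun s => s.2.2⟩, rfl, fun f φ => ?_⟩
  refine Eq.trans ?_ (hsum φ)
  exact Finset.sum_congr rfl fun s _ => by simp only [Experiment.state, runState, hLs]

theorem realizable_pure {n m : ℕ} (hn : 0 < n) {Ω : Type} (ω : Ω) :
    Realizable (n := n) (m := m) 0 (fun _ φ => φ ω) := by
  let s₀ : BasisState n m Unit := (⟨0, hn⟩, fun _ => false, ())
  refine ⟨⟨0, Unit, s₀, fun _ => LinearMap.id, fun _ => NormPreserving.id, fun _ => ω⟩, rfl,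
    fun f φ => ?_⟩
  exact Experiment.expect_const (Ω := Ω) ⟨0, Unit, s₀, fun _ => LinearMap.id, fun _ => NormPreserving.id, fun _ => ω⟩ f (φ ω)

theorem realizable_query {n m : ℕ} (x : Fin n) (hm : 0 < m) :
    Realizable (n := n) (m := m) 1 (fun f φ => φ (f x)) := by
  classical
  let s₀ : BasisState n m Unit := (x, fun _ => false, ())
  let A : Experiment n m (Fin m) := ⟨1, Unit, s₀, fun _ => LinearMap.id,
    fun _ => NormPreserving.id,
    fun s => if h : ∃ y : Fin m, encodeBits y = s.2.1 then h.choose else ⟨0, hm⟩⟩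
  refine ⟨A, rfl, fun f φ => ?_⟩
  have hst : A.state f 1 = Pi.single (oracleShift f s₀) 1 := oracle_single f s₀
  have ho : A.outcome (oracleShift f s₀) = f x := by
    have h : ∃ y : Fin m, encodeBits y = (oracleShift f s₀).2.1 :=
      ⟨f x, by funext k; simp [oracleShift, s₀]⟩
    have h2 : A.outcome (oracleShift f s₀) = h.choose := dif_pos h
    rw [h2]
    apply encodeBits_injective
    rw [h.choose_spec]
    funext k; simp [oracleShift, s₀]
  change ∑ s, ‖A.state f 1 s‖ ^ 2 * φ (A.outcome s) = φ (f x)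
  rw [hst, Finset.sum_eq_single (oracleShift f s₀)]
  · simp [ho]
  · intro s _ hs
    simp [hs]
  · simp

/-! ### Sequential composition with deferred measurement. -/

/-- The basis of a two-stage computation consists of a block for the first stage and, for every
basis state `s` of the first stage, a block for the second stage after `s`. -/
def twoStageEquiv (n m : ℕ) (W : Type) (W' : BasisState n m W → Type) :
    BasisState n m (W ⊕ Σ s : BasisState n m W, W' s) ≃
      BasisState n m W ⊕ Σ s : BasisState n m W, BasisState n m (W' s) where
  toFun
    | (x, b, Sum.inl w) => Sum.inl (x, b, w)
    | (x, b, Sum.inr ⟨s, w⟩) => Sum.inr ⟨s, x, b, w⟩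
  invFun
    | Sum.inl (x, b, w) => (x, b, Sum.inl w)
    | Sum.inr ⟨s, x, b, w⟩ => (x, b, Sum.inr ⟨s, w⟩)
  left_inv := by rintro ⟨x, b, w | ⟨s, w⟩⟩ <;> rfl
  right_inv := by rintro (⟨x, b, w⟩ | ⟨s, x, b, w⟩) <;> rfl

section TwoStage

variable {n m : ℕ} {W : Type} {W' : BasisState n m W → Type}

/-- The block diagonal map with blocks `L` and `L' s`. -/
def blockLin (L : (BasisState n m W → ℂ) →ₗ[ℂ] (BasisState n m W → ℂ))
    (L' : ∀ s, (BasisState n m (W' s) → ℂ) →ₗ[ℂ] (BasisState n m (W' s) → ℂ)) :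
    (BasisState n m (W ⊕ Σ s, W' s) → ℂ) →ₗ[ℂ] (BasisState n m (W ⊕ Σ s, W' s) → ℂ) where
  toFun ψ r :=
    match twoStageEquiv n m W W' r with
    | Sum.inl u => L (fun v => ψ ((twoStageEquiv n m W W').symm (Sum.inl v))) u
    | Sum.inr ⟨s, u⟩ => L' s (fun v => ψ ((twoStageEquiv n m W W').symm (Sum.inr ⟨s, v⟩))) u
  map_add' ψ φ := by
    funext r
    rcases h : twoStageEquiv n m W W' r with u | ⟨s, u⟩
    · simp only [h, Pi.add_apply]
      exact congrFun (map_add L (fun v => ψ ((twoStageEquiv n m W W').symm (Sum.inl v)))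
        (fun v => φ ((twoStageEquiv n m W W').symm (Sum.inl v)))) u
    · simp only [h, Pi.add_apply]
      exact congrFun (map_add (L' s)
        (fun v => ψ ((twoStageEquiv n m W W').symm (Sum.inr ⟨s, v⟩)))
        (fun v => φ ((twoStageEquiv n m W W').symm (Sum.inr ⟨s, v⟩)))) u
  map_smul' c ψ := by
    funext r
    rcases h : twoStageEquiv n m W W' r with u | ⟨s, u⟩
    · simp only [h, Pi.smul_apply]
      exact congrFun (map_smul L c
        (fun v => ψ ((twoStageEquiv n m W W').symm (Sum.inl v)))) u
    · simp only [h, Pi.smul_apply]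
      exact congrFun (map_smul (L' s) c
        (fun v => ψ ((twoStageEquiv n m W W').symm (Sum.inr ⟨s, v⟩)))) u

/-- The vector with block `ψ` for the first stage and blocks `ψ' s` for the second stage. -/
def blockVec (ψ : BasisState n m W → ℂ) (ψ' : ∀ s, BasisState n m (W' s) → ℂ) :
    BasisState n m (W ⊕ Σ s, W' s) → ℂ := fun r =>
  match twoStageEquiv n m W W' r with
  | Sum.inl u => ψ u
  | Sum.inr ⟨s, u⟩ => ψ' s u

theorem blockLin_blockVec (L : (BasisState n m W → ℂ) →ₗ[ℂ] (BasisState n m W → ℂ))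
    (L' : ∀ s, (BasisState n m (W' s) → ℂ) →ₗ[ℂ] (BasisState n m (W' s) → ℂ))
    (ψ : BasisState n m W → ℂ) (ψ' : ∀ s, BasisState n m (W' s) → ℂ) :
    blockLin L L' (blockVec ψ ψ') = blockVec (L ψ) (fun s => L' s (ψ' s)) := by
  funext r
  rcases h : twoStageEquiv n m W W' r with u | ⟨s, u⟩ <;> simp [blockLin, blockVec, h]

theorem oracle_blockVec (f : Fin n → Fin m)
    (ψ : BasisState n m W → ℂ) (ψ' : ∀ s, BasisState n m (W' s) → ℂ) :
    oracle f (blockVec ψ ψ') = blockVec (oracle f ψ) (fun s => oracle f (ψ' s)) := by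
  funext ⟨x, b, w⟩
  rcases w with w | ⟨s, w⟩ <;> rfl

theorem exists_eq_blockVec (φ : BasisState n m (W ⊕ Σ s, W' s) → ℂ) :
    ∃ (ψ : BasisState n m W → ℂ) (ψ' : ∀ s, BasisState n m (W' s) → ℂ), φ = blockVec ψ ψ' :=
  ⟨fun v => φ ((twoStageEquiv n m W W').symm (Sum.inl v)),
    fun s v => φ ((twoStageEquiv n m W W').symm (Sum.inr ⟨s, v⟩)), by
      funext ⟨x, b, w⟩
      rcases w with w | ⟨s, w⟩ <;> rfl⟩

theorem sum_twoStage [Fintype W] [∀ s, Fintype (W' s)]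
    (F : BasisState n m (W ⊕ Σ s, W' s) → ℝ) :
    ∑ r, F r = ∑ u, F ((twoStageEquiv n m W W').symm (Sum.inl u)) +
      ∑ s, ∑ u, F ((twoStageEquiv n m W W').symm (Sum.inr ⟨s, u⟩)) := by
  rw [← Equiv.sum_comp (twoStageEquiv n m W W').symm, Fintype.sum_sum_type, Fintype.sum_sigma]

theorem stateNormSq_blockVec [Fintype W] [∀ s, Fintype (W' s)]
    (ψ : BasisState n m W → ℂ) (ψ' : ∀ s, BasisState n m (W' s) → ℂ) :
    stateNormSq (blockVec ψ ψ') = stateNormSq ψ + ∑ s, stateNormSq (ψ' s) := by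
  rw [stateNormSq, sum_twoStage]
  simp [blockVec, stateNormSq]

theorem NormPreserving.blockLin [Fintype W] [∀ s, Fintype (W' s)]
    {L : (BasisState n m W → ℂ) →ₗ[ℂ] (BasisState n m W → ℂ)}
    {L' : ∀ s, (BasisState n m (W' s) → ℂ) →ₗ[ℂ] (BasisState n m (W' s) → ℂ)}
    (h : NormPreserving L) (h' : ∀ s, NormPreserving (L' s)) :
    NormPreserving (blockLin L L') := by
  intro φ
  obtain ⟨ψ, ψ', rfl⟩ := exists_eq_blockVec φ
  rw [blockLin_blockVec, stateNormSq_blockVec, stateNormSq_blockVec, h]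
  exact congrArg _ (Finset.sum_congr rfl fun s _ => h' s _)

open Classical in
/-- The involution that exchanges the basis state `s` of the first stage with the initial state
of the second stage after `s`. -/
noncomputable def transferPerm (i : ∀ s, BasisState n m (W' s)) :
    Equiv.Perm (BasisState n m W ⊕ Σ s : BasisState n m W, BasisState n m (W' s)) :=
  Function.Involutive.toPerm
    (fun r => match r with
      | Sum.inl s => Sum.inr ⟨s, i s⟩
      | Sum.inr ⟨s, u⟩ => if u = i s then Sum.inl s else Sum.inr ⟨s, u⟩)
    (by
      rintro (s | ⟨s, u⟩)
      · simp
      · by_cases h : u = i s <;> simp [h])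

theorem transferPerm_inl (i : ∀ s, BasisState n m (W' s)) (s : BasisState n m W) :
    transferPerm i (Sum.inl s) = Sum.inr ⟨s, i s⟩ := rfl

open Classical in
theorem transferPerm_inr (i : ∀ s, BasisState n m (W' s)) (s : BasisState n m W)
    (u : BasisState n m (W' s)) :
    transferPerm i (Sum.inr ⟨s, u⟩) = if u = i s then Sum.inl s else Sum.inr ⟨s, u⟩ := rfl

/-- The unitary that starts the second stage. -/
noncomputable def transferLin (i : ∀ s, BasisState n m (W' s)) :
    (BasisState n m (W ⊕ Σ s, W' s) → ℂ) →ₗ[ℂ] (BasisState n m (W ⊕ Σ s, W' s) → ℂ) :=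
  LinearMap.funLeft ℂ ℂ
    (((twoStageEquiv n m W W').trans (transferPerm i)).trans (twoStageEquiv n m W W').symm)

theorem normPreserving_transferLin [Fintype W] [∀ s, Fintype (W' s)]
    (i : ∀ s, BasisState n m (W' s)) :
    NormPreserving (transferLin i) := NormPreserving.funLeft _

/-- Different outcomes of the first stage are sent to orthogonal blocks, so they no longer
interfere: the effect is that of a measurement, with `ψ s` the amplitude of the branch `s`. -/
theorem transferLin_blockVec [∀ s, DecidableEq (W' s)] (i : ∀ s, BasisState n m (W' s))
    (ψ : BasisState n m W → ℂ) :
    transferLin i (blockVec ψ 0) = blockVec 0 (fun s => ψ s • Pi.single (i s) (1 : ℂ)) := by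
  funext r
  rcases h : twoStageEquiv n m W W' r with u | ⟨s, u⟩
  · simp [transferLin, LinearMap.funLeft_apply, blockVec, h, transferPerm_inl]
  · by_cases hu : u = i s <;>
      simp [transferLin, LinearMap.funLeft_apply, blockVec, h, transferPerm_inr, hu]

end TwoStage

theorem blockVec_single {n m : ℕ} {W : Type} {W' : BasisState n m W → Type} [DecidableEq W]
    [DecidableEq (W ⊕ Σ s, W' s)] (s : BasisState n m W) :
    blockVec (W' := W') (Pi.single s 1) 0 =
      (Pi.single ((twoStageEquiv n m W W').symm (Sum.inl s)) 1 :
        BasisState n m (W ⊕ Σ s, W' s) → ℂ) := by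
  funext r
  have hr : (r = (twoStageEquiv n m W W').symm (Sum.inl s)) ↔
      twoStageEquiv n m W W' r = Sum.inl s := by
    rw [Equiv.eq_symm_apply]
  rcases h : twoStageEquiv n m W W' r with u | ⟨s', u⟩ <;>
    simp [blockVec, h, Pi.single_apply, hr]

namespace Experiment

variable {n m : ℕ} {Ω Ω' : Type}

/-- The unitaries of the two-stage experiment `Experiment.bind`. -/
noncomputable def bindStep (A : Experiment n m Ω) (A' : Ω → Experiment n m Ω') (k : ℕ) :
    (BasisState n m (A.Work ⊕ Σ s : BasisState n m A.Work, (A' (A.outcome s)).Work) → ℂ) →ₗ[ℂ]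
      (BasisState n m (A.Work ⊕ Σ s : BasisState n m A.Work, (A' (A.outcome s)).Work) → ℂ) :=
  if k < A.queries then blockLin (A.step k) (fun _ => LinearMap.id)
  -- Between two oracle calls only one unitary is available, so the last step of `A`, the transfer
  -- and the initial step of the second stage are merged.
  else if k = A.queries then
    blockLin LinearMap.id (fun s => (A' (A.outcome s)).step 0) ∘ₗ
      transferLin (fun s => (A' (A.outcome s)).init) ∘ₗ
        blockLin (A.step k) (fun _ => LinearMap.id)
  else blockLin LinearMap.id (fun s => (A' (A.outcome s)).step (k - A.queries))

/-- Run `A`, then an experiment that depends on the outcome of `A`. -/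
noncomputable def bind (A : Experiment n m Ω) (A' : Ω → Experiment n m Ω') (T : ℕ)
    (ω₀ : Ω') : Experiment n m Ω' where
  queries := A.queries + T
  Work := A.Work ⊕ Σ s : BasisState n m A.Work, (A' (A.outcome s)).Work
  init := (twoStageEquiv n m A.Work _).symm (Sum.inl A.init)
  step := A.bindStep A'
  normPreserving_step k := by
    unfold bindStep
    split_ifs
    · exact (A.normPreserving_step k).blockLin fun _ => NormPreserving.id
    · exact (NormPreserving.id.blockLin fun s => (A' (A.outcome s)).normPreserving_step 0).comp
        ((normPreserving_transferLin _).comp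
          ((A.normPreserving_step k).blockLin fun _ => NormPreserving.id))
    · exact NormPreserving.id.blockLin fun s => (A' (A.outcome s)).normPreserving_step _
  outcome r :=
    match twoStageEquiv n m A.Work (fun s => (A' (A.outcome s)).Work) r with
    | Sum.inl _ => ω₀
    | Sum.inr ⟨s, u⟩ => (A' (A.outcome s)).outcome u

/-- Before the transfer the second-stage blocks are zero, so the oracle and the block diagonal steps
act only on the first block. -/
theorem runState_bindStep_lt (A : Experiment n m Ω) (A' : Ω → Experiment n m Ω')
    (f : Fin n → Fin m) (k : ℕ) (hk : k < A.queries) :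
    runState (A.bindStep A') ((twoStageEquiv n m A.Work _).symm (Sum.inl A.init)) f k =
      blockVec (A.state f k) 0 := by
  induction k with
  | zero =>
    rw [runState, bindStep, if_pos hk,
      ← blockVec_single (W' := fun s => (A' (A.outcome s)).Work), blockLin_blockVec]
    rfl
  | succ k ih =>
    rw [runState, ih (by omega), oracle_blockVec, bindStep, if_pos hk, blockLin_blockVec]
    rfl

theorem runState_bindStep_add (A : Experiment n m Ω) (A' : Ω → Experiment n m Ω')
    (f : Fin n → Fin m) (k : ℕ) :
    runState (A.bindStep A') ((twoStageEquiv n m A.Work _).symm (Sum.inl A.init)) f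
        (A.queries + k) =
      blockVec 0 (fun s => A.state f A.queries s • (A' (A.outcome s)).state f k) := by
  have key : ∀ ψ : BasisState n m A.Work → ℂ,
      A.bindStep A' A.queries (blockVec ψ 0) =
        blockVec 0 (fun s => A.step A.queries ψ s • (A' (A.outcome s)).state f 0) := by
    intro ψ
    rw [bindStep, if_neg (lt_irrefl _), if_pos rfl, LinearMap.comp_apply, LinearMap.comp_apply,
      blockLin_blockVec]
    have h0 : (fun s => LinearMap.id (R := ℂ) ((0 : ∀ s : BasisState n m A.Work,
        BasisState n m (A' (A.outcome s)).Work → ℂ) s)) = 0 := rfl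
    rw [h0, transferLin_blockVec, blockLin_blockVec]
    congr 1
    funext s
    exact map_smul ((A' (A.outcome s)).step 0) _ _
  induction k with
  | zero =>
    rw [Nat.add_zero]
    -- If `A` makes no query, its last step is also its first one and acts on the initial basis
    -- state; otherwise it follows an oracle call.
    rcases hq : A.queries with _ | q
    · rw [hq] at key
      rw [runState, ← blockVec_single (W' := fun s => (A' (A.outcome s)).Work)]
      exact key (Pi.single A.init 1)
    · rw [runState, runState_bindStep_lt _ _ _ _ (by omega), oracle_blockVec]
      rw [hq] at key
      exact key _
  | succ k ih =>
    rw [← Nat.add_assoc, runState, ih, oracle_blockVec, bindStep, if_neg (by omega),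
      if_neg (by omega), show A.queries + k + 1 - A.queries = k + 1 by omega, blockLin_blockVec]
    congr 1
    funext s
    exact map_smul ((A' (A.outcome s)).step (k + 1)) (A.state f A.queries s)
      (oracle f ((A' (A.outcome s)).state f k))

/-- The squared amplitudes of a branch factor into the probability of `s` and those of the second
stage. All second stages need the same number of queries because the oracle acts on all branches
simultaneously. -/
theorem bind_expect (A : Experiment n m Ω) (A' : Ω → Experiment n m Ω') (T : ℕ) (ω₀ : Ω')
    (hT : ∀ ω, (A' ω).queries = T) (f : Fin n → Fin m) (φ : Ω' → ℝ) :
    (A.bind A' T ω₀).expect f φ = A.expect f (fun ω => (A' ω).expect f φ) := by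
  have h : (A.bind A' T ω₀).expect f φ =
      ∑ s, ‖runState (A.bindStep A') ((twoStageEquiv n m A.Work _).symm (Sum.inl A.init)) f
        (A.queries + T) s‖ ^ 2 * φ ((A.bind A' T ω₀).outcome s) := rfl
  rw [h, runState_bindStep_add]
  refine (sum_twoStage _).trans ?_
  rw [Finset.sum_eq_zero, zero_add]
  · refine Finset.sum_congr rfl fun s _ => ?_
    simp only [expect]
    rw [Finset.mul_sum]
    refine Finset.sum_congr rfl fun u _ => ?_
    simp [blockVec, bind, hT, mul_pow, mul_assoc]
  · intro u _
    simp [blockVec]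

end Experiment

/-! ### Composition and padding of realizable expectations. -/

theorem Realizable.bind {n m : ℕ} {Ω Ω' : Type} [Nonempty Ω'] {T T' : ℕ}
    {E : (Fin n → Fin m) → (Ω → ℝ) → ℝ} {E' : Ω → (Fin n → Fin m) → (Ω' → ℝ) → ℝ}
    (h : Realizable T E) (h' : ∀ ω, Realizable T' (E' ω)) :
    Realizable (T + T') (fun f φ => E f (fun ω => E' ω f φ)) := by
  obtain ⟨A, hA, hE⟩ := h
  choose A' hA' hE' using h'
  refine ⟨A.bind A' T' (Classical.arbitrary Ω'), ?_, fun f φ => ?_⟩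
  · rw [← hA]; rfl
  · rw [A.bind_expect A' T' _ hA', hE]
    simp only [hE']

/-- Queries whose answers are discarded; they pad branches to a common length, as `Realizable.bind`
requires. -/
theorem realizable_idle {n m : ℕ} (hn : 0 < n) (hm : 0 < m) {Ω : Type} (ω : Ω) (T : ℕ) :
    Realizable (n := n) (m := m) T (fun _ φ => φ ω) := by
  induction T with
  | zero => exact realizable_pure hn ω
  | succ T ih =>
    have : Nonempty Ω := ⟨ω⟩
    exact ih.bind (E' := fun ω' _ φ => φ ω') fun ω' =>
      (realizable_query ⟨0, hn⟩ hm).bind (E' := fun _ _ φ => φ ω') (T' := 0)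
        fun _ => realizable_pure hn ω'

theorem Realizable.mono {n m : ℕ} (hn : 0 < n) (hm : 0 < m) {Ω : Type} [Nonempty Ω] {T T' : ℕ}
    {E : (Fin n → Fin m) → (Ω → ℝ) → ℝ} (h : Realizable T E) (hT : T ≤ T') :
    Realizable T' E := by
  have := h.bind (E' := fun ω _ φ => φ ω) fun ω => realizable_idle hn hm ω (T' - T)
  rwa [Nat.add_sub_cancel' hT] at this

/-- The values of `f` on a set of `k` points can be found with `k` queries. -/
theorem realizable_queries {n m : ℕ} (hn : 0 < n) (hm : 0 < m) (S : Finset (Fin n)) :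
    Realizable (n := n) (m := m) S.card
      (fun f φ => φ (fun x => if x ∈ S then f x else ⟨0, hm⟩)) := by
  induction S using Finset.induction_on with
  | empty => simpa using realizable_pure hn (fun _ : Fin n => (⟨0, hm⟩ : Fin m))
  | insert a S ha ih =>
    have : Nonempty (Fin n → Fin m) := ⟨fun _ => ⟨0, hm⟩⟩
    rw [Finset.card_insert_of_notMem ha]
    -- The table `h` of known values is the classical outcome so far; one more query fills in its
    -- entry at `a`.
    have := ih.bind (T' := 1) (E' := fun h f φ => φ (Function.update h a (f a))) fun h =>
      (realizable_query a hm).bind (T' := 0) (E' := fun y _ φ => φ (Function.update h a y))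
        fun y => realizable_pure hn _
    convert this using 4 with f φ
    funext x
    by_cases hx : x = a
    · subst hx; simp
    · simp [hx]

/-! ### Fourier analysis of the counter register -/

/-- The root of unity of the discrete Fourier transform. -/
noncomputable def dftRoot (M : ℕ) : ℂ := Complex.exp (2 * Real.pi * Complex.I / M)

theorem norm_dftRoot (M : ℕ) : ‖dftRoot M‖ = 1 := by
  have : (2 * Real.pi * Complex.I / M : ℂ) = ((2 * Real.pi / M : ℝ) : ℂ) * Complex.I := by
    push_cast; ring
  rw [dftRoot, this, Complex.norm_exp_ofReal_mul_I]

theorem sum_dftRoot {M : ℕ} (hM : 0 < M) (c c' : Fin M) :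
    ∑ y : Fin M, dftRoot M ^ (c * y : ℕ) * (starRingEnd ℂ) (dftRoot M ^ (c' * y : ℕ)) =
      if c = c' then (M : ℂ) else 0 := by
  have hω : IsPrimitiveRoot (dftRoot M) M := Complex.isPrimitiveRoot_exp M hM.ne'
  have h1 : dftRoot M * (starRingEnd ℂ) (dftRoot M) = 1 := by
    rw [Complex.mul_conj, Complex.normSq_eq_norm_sq, norm_dftRoot]; norm_num
  set ξ := dftRoot M ^ (c : ℕ) * (starRingEnd ℂ) (dftRoot M) ^ (c' : ℕ) with hξ
  have hterm : ∀ y : Fin M, dftRoot M ^ (c * y : ℕ) * (starRingEnd ℂ) (dftRoot M ^ (c' * y : ℕ)) =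
      ξ ^ (y : ℕ) := fun y => by
    rw [hξ, mul_pow, map_pow, pow_mul, pow_mul]
  simp only [hterm]
  rw [Fin.sum_univ_eq_sum_range (fun y => ξ ^ y) M]
  split_ifs with h
  · subst h
    have : ξ = 1 := by rw [hξ, ← mul_pow, h1, one_pow]
    simp [this]
  · have hne : ξ ≠ 1 := by
      intro hξ1
      apply h
      apply Fin.ext
      apply hω.pow_inj c.2 c'.2
      calc dftRoot M ^ (c : ℕ)
          = dftRoot M ^ (c : ℕ) * (dftRoot M * (starRingEnd ℂ) (dftRoot M)) ^ (c' : ℕ) := by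
            rw [h1, one_pow, mul_one]
        _ = ξ * dftRoot M ^ (c' : ℕ) := by rw [hξ]; ring
        _ = _ := by rw [hξ1, one_mul]
    have hM1 : ξ ^ M = 1 := by
      have hc : (starRingEnd ℂ) (dftRoot M) ^ M = 1 := by
        rw [← map_pow, hω.pow_eq_one, map_one]
      rw [hξ, mul_pow, pow_right_comm, hω.pow_eq_one, pow_right_comm, hc, one_pow, one_pow, one_mul]
    have := mul_neg_geom_sum ξ M
    rw [hM1, sub_self] at this
    exact (mul_eq_zero.mp this).resolve_left (sub_ne_zero.mpr hne.symm)

/-- Parseval's identity. -/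
theorem sum_norm_sq_dft {M : ℕ} (hM : 0 < M) (ψ : Fin M → ℂ) :
    ∑ y : Fin M, ‖∑ c : Fin M, dftRoot M ^ (c * y : ℕ) * ψ c‖ ^ 2 = M * ∑ c, ‖ψ c‖ ^ 2 := by
  have key : ∑ y : Fin M, (∑ c : Fin M, dftRoot M ^ (c * y : ℕ) * ψ c) *
      (starRingEnd ℂ) (∑ c : Fin M, dftRoot M ^ (c * y : ℕ) * ψ c) =
      M * ∑ c, ψ c * (starRingEnd ℂ) (ψ c) := by
    calc _ = ∑ c : Fin M, ∑ c' : Fin M, ψ c * (starRingEnd ℂ) (ψ c') * ∑ y : Fin M,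
          dftRoot M ^ (c * y : ℕ) * (starRingEnd ℂ) (dftRoot M ^ (c' * y : ℕ)) := by
          simp only [map_sum, Finset.sum_mul_sum]
          simp only [Finset.mul_sum, map_mul]
          rw [Finset.sum_comm]
          refine Finset.sum_congr rfl fun c _ => ?_
          rw [Finset.sum_comm]
          refine Finset.sum_congr rfl fun c' _ => Finset.sum_congr rfl fun y _ => ?_
          ring
      _ = _ := by
          simp only [sum_dftRoot hM]
          rw [Finset.mul_sum]
          refine Finset.sum_congr rfl fun c _ => ?_
          rw [Finset.sum_eq_single c]
          · simp [mul_comm]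
          · intro c' _ h
            simp [h.symm]
          · simp
  simp only [Complex.mul_conj, Complex.normSq_eq_norm_sq] at key
  exact_mod_cast key

/-- The amplitudes of the counter register, up to normalization. -/
noncomputable def window (M c : ℕ) : ℝ := c * (M - c)

theorem sum_range_id_real (M : ℕ) : ∑ c ∈ Finset.range M, (c : ℝ) = M * (M - 1) / 2 := by
  induction M with
  | zero => simp
  | succ M ih => rw [Finset.sum_range_succ, ih]; push_cast; ring

theorem sum_range_sq_real (M : ℕ) :
    ∑ c ∈ Finset.range M, (c : ℝ) ^ 2 = M * (M - 1) * (2 * M - 1) / 6 := by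
  induction M with
  | zero => simp
  | succ M ih => rw [Finset.sum_range_succ, ih]; push_cast; ring

theorem sum_range_cube_real (M : ℕ) :
    ∑ c ∈ Finset.range M, (c : ℝ) ^ 3 = (M * (M - 1) / 2) ^ 2 := by
  induction M with
  | zero => simp
  | succ M ih => rw [Finset.sum_range_succ, ih]; push_cast; ring

theorem sum_range_fourth_real (M : ℕ) :
    ∑ c ∈ Finset.range M, (c : ℝ) ^ 4 =
      M * (M - 1) * (2 * M - 1) * (3 * M ^ 2 - 3 * M - 1) / 30 := by
  induction M with
  | zero => simp
  | succ M ih => rw [Finset.sum_range_succ, ih]; push_cast; ring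

theorem sum_window_sq (M : ℕ) :
    ∑ c : Fin M, window M c ^ 2 = (M : ℝ) * (M ^ 4 - 1) / 30 := by
  rw [Fin.sum_univ_eq_sum_range (fun c => window M c ^ 2) M]
  have : ∀ c : ℕ, window M c ^ 2 = M ^ 2 * (c : ℝ) ^ 2 - 2 * M * (c : ℝ) ^ 3 + (c : ℝ) ^ 4 :=
    fun c => by rw [window]; ring
  simp only [this, Finset.sum_add_distrib, Finset.sum_sub_distrib, ← Finset.mul_sum,
    sum_range_sq_real, sum_range_cube_real, sum_range_fourth_real]
  ring

theorem sum_window_diff_sq (M : ℕ) :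
    ∑ c : Fin M, ((M : ℝ) - 2 * (c : ℕ) - 1) ^ 2 = (M : ℝ) * (M ^ 2 - 1) / 3 := by
  rw [Fin.sum_univ_eq_sum_range (fun c => ((M : ℝ) - 2 * c - 1) ^ 2) M]
  have : ∀ c : ℕ, ((M : ℝ) - 2 * c - 1) ^ 2 =
      ((M : ℝ) - 1) ^ 2 - 4 * (M - 1) * c + 4 * (c : ℝ) ^ 2 := fun c => by ring
  simp only [this, Finset.sum_add_distrib, Finset.sum_sub_distrib, ← Finset.mul_sum,
    sum_range_sq_real, sum_range_id_real, Finset.sum_const, Finset.card_range, nsmul_eq_mul]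
  ring

/-- Summation by parts: `window` vanishes at both ends `0` and `M`, so there are no boundary terms,
and its increments are `M - 2c - 1`. -/
theorem one_sub_mul_sum_window (M : ℕ) (ζ : ℂ) :
    (1 - ζ) * ∑ c : Fin M, (window M c : ℂ) * ζ ^ (c : ℕ) =
      ζ * ∑ c : Fin M, (((M : ℝ) - 2 * (c : ℕ) - 1 : ℝ) : ℂ) * ζ ^ (c : ℕ) := by
  rw [Fin.sum_univ_eq_sum_range (fun c => (window M c : ℂ) * ζ ^ c) M,
    Fin.sum_univ_eq_sum_range (fun c => (((M : ℝ) - 2 * c - 1 : ℝ) : ℂ) * ζ ^ c) M]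
  have h := Finset.sum_range_succ (fun c => (window M c : ℂ) * ζ ^ c) M
  rw [Finset.sum_range_succ'] at h
  have h0 : ((window M 0 : ℝ) : ℂ) = 0 := by simp [window]
  have hM : ((window M M : ℝ) : ℂ) = 0 := by simp [window]
  rw [h0, hM, zero_mul, zero_mul, add_zero, add_zero] at h
  rw [sub_mul, one_mul]
  nth_rewrite 1 [← h]
  rw [Finset.mul_sum, Finset.mul_sum, ← Finset.sum_sub_distrib]
  refine Finset.sum_congr rfl fun c _ => ?_
  simp only [window]
  push_cast
  ring

/-- The factor `|1 - zω^y|`, which will dominate the estimation error, turns the transform of the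
window into that of its increments; Parseval then evaluates the weighted sum exactly. -/
theorem sum_window_dft {M : ℕ} (hM : 0 < M) {z : ℂ} (hz : ‖z‖ = 1) :
    ∑ y : Fin M, ‖1 - z * dftRoot M ^ (y : ℕ)‖ ^ 2 *
      ‖∑ c : Fin M, (window M c : ℂ) * (z * dftRoot M ^ (y : ℕ)) ^ (c : ℕ)‖ ^ 2 =
      M * (M * (M ^ 2 - 1) / 3) := by
  rw [← sum_window_diff_sq]
  have hP := sum_norm_sq_dft hM
    (fun c : Fin M => (((M : ℝ) - 2 * (c : ℕ) - 1 : ℝ) : ℂ) * z ^ (c : ℕ))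
  simp only [norm_mul, norm_pow, hz, one_pow, mul_one, Complex.norm_real, Real.norm_eq_abs,
    sq_abs] at hP
  rw [← hP]
  refine Finset.sum_congr rfl fun y _ => ?_
  rw [← mul_pow, ← norm_mul, one_sub_mul_sum_window, norm_mul, norm_mul, norm_pow, hz,
    norm_dftRoot, one_pow, one_mul, one_mul]
  congr 2
  refine Finset.sum_congr rfl fun c _ => ?_
  rw [mul_pow, ← pow_mul, mul_comm (y : ℕ)]
  ring

/-! ### Amplitude amplification -/

/-- The amplitudes of marked and unmarked points after `k` rounds of amplitude amplification,
relative to their initial value, if the fraction `a` of the points is marked. -/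
noncomputable def groverAmp (a : ℝ) : ℕ → ℝ × ℝ
  | 0 => (1, 1)
  | k + 1 => ((1 - 2 * a) * (groverAmp a k).1 + 2 * (1 - a) * (groverAmp a k).2,
      -2 * a * (groverAmp a k).1 + (1 - 2 * a) * (groverAmp a k).2)

/-- Each round rotates by `2θ`. Stating this for amplitudes relative to `sin θ` and `cos θ` avoids
division when no point or every point is marked. -/
theorem groverAmp_eq (θ : ℝ) (k : ℕ) :
    Real.sin θ * (groverAmp (Real.sin θ ^ 2) k).1 = Real.sin ((2 * k + 1) * θ) ∧
      Real.cos θ * (groverAmp (Real.sin θ ^ 2) k).2 = Real.cos ((2 * k + 1) * θ) := by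
  induction k with
  | zero => simp [groverAmp]
  | succ k ih =>
    obtain ⟨h1, h2⟩ := ih
    have e : (2 * ((k + 1 : ℕ) : ℝ) + 1) * θ = (2 * k + 1) * θ + 2 * θ := by push_cast; ring
    rw [e, Real.sin_add, Real.cos_add, ← h1, ← h2, Real.sin_two_mul, Real.cos_two_mul]
    have hc : Real.cos θ ^ 2 = 1 - Real.sin θ ^ 2 := Real.cos_sq' θ
    simp only [groverAmp]
    constructor
    · linear_combination (-2 * Real.sin θ * (groverAmp (Real.sin θ ^ 2) k).1 -
        2 * Real.sin θ * (groverAmp (Real.sin θ ^ 2) k).2) * hc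
    · linear_combination (-2 * Real.cos θ * (groverAmp (Real.sin θ ^ 2) k).2) * hc

/-- The outcome of amplitude estimation that belongs to the counter value `y`. -/
noncomputable def ampOutcome (M y : ℕ) : ℝ := |Real.sin (Real.pi * y / M)|

theorem norm_one_sub_exp_sq (x : ℝ) :
    ‖1 - Complex.exp (((2 * x : ℝ) : ℂ) * Complex.I)‖ ^ 2 = 4 * Real.sin x ^ 2 := by
  rw [← Complex.normSq_eq_norm_sq, Complex.exp_mul_I, ← Complex.ofReal_cos, ← Complex.ofReal_sin,
    Complex.normSq_apply]
  simp only [Complex.sub_re, Complex.one_re, Complex.add_re, Complex.ofReal_re, Complex.mul_re,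
    Complex.I_re, Complex.ofReal_im, Complex.I_im, Complex.sub_im, Complex.one_im, Complex.add_im,
    Complex.mul_im]
  rw [Real.cos_two_mul, Real.sin_two_mul]
  have hc := Real.sin_sq_add_cos_sq x
  linear_combination (4 * Real.cos x ^ 2 - 4) * hc

/-- Expand `sin u = sin((u+v) - v)`. The sum `u + v` matches the phase of `zω^y` below. -/
theorem abs_abs_sin_sub_le (u v : ℝ) : |(|Real.sin u| - |Real.sin v|)| ≤ |Real.sin (u + v)| := by
  have key : ∀ u v : ℝ, |Real.sin u| - |Real.sin v| ≤ |Real.sin (u + v)| := by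
    intro u v
    have h : Real.sin u = Real.sin (u + v) * Real.cos v - Real.cos (u + v) * Real.sin v := by
      rw [← Real.sin_sub]; ring_nf
    have h1 : |Real.sin u| ≤ |Real.sin (u + v)| * |Real.cos v| +
        |Real.cos (u + v)| * |Real.sin v| := by
      rw [← abs_mul, ← abs_mul]
      nth_rewrite 1 [h]
      exact abs_sub _ _
    have h2 := mul_le_mul_of_nonneg_left (Real.abs_cos_le_one v) (abs_nonneg (Real.sin (u + v)))
    have h3 := mul_le_mul_of_nonneg_right (Real.abs_cos_le_one (u + v)) (abs_nonneg (Real.sin v))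
    linarith
  rw [abs_le]
  have h1 := key u v
  have h2 := key v u
  rw [add_comm v u] at h2
  constructor <;> linarith

/-- The signs `σ = ±1` belong to the two eigenphases `±2θ` of the rotation; since the outcome is an
absolute value of a sine, either phase leads to the same estimate. -/
theorem ampOutcome_sub_sq_le {M : ℕ} (y : ℕ) {θ : ℝ} (h0 : 0 ≤ Real.sin θ) (σ : ℝ)
    (hσ : σ = 1 ∨ σ = -1) :
    (ampOutcome M y - Real.sin θ) ^ 2 ≤
      ‖1 - Complex.exp (((2 * (σ * θ) : ℝ) : ℂ) * Complex.I) * dftRoot M ^ y‖ ^ 2 / 4 := by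
  have e : Complex.exp (((2 * (σ * θ) : ℝ) : ℂ) * Complex.I) * dftRoot M ^ y =
      Complex.exp (((2 * (σ * θ + Real.pi * y / M) : ℝ) : ℂ) * Complex.I) := by
    rw [dftRoot, ← Complex.exp_nat_mul, ← Complex.exp_add]
    congr 1
    push_cast
    ring
  rw [e, norm_one_sub_exp_sq]
  have h := abs_abs_sin_sub_le (Real.pi * y / M) (σ * θ)
  have hs : |Real.sin (σ * θ)| = Real.sin θ := by
    rcases hσ with rfl | rfl
    · rw [one_mul, abs_of_nonneg h0]
    · rw [neg_one_mul, Real.sin_neg, abs_neg, abs_of_nonneg h0]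
  rw [hs] at h
  have := sq_le_sq' (abs_le.mp h).1 (abs_le.mp h).2
  rw [sq_abs] at this
  rw [ampOutcome, add_comm (σ * θ)]
  linarith

/-- The parallelogram law for `C ± iS`, where `S` and `C` are the sine and cosine sums. It passes to
the eigenphases without diagonalizing the rotation. -/
theorem norm_sq_add_norm_sq_rotate {ι : Type*} [Fintype ι] (g : ι → ℂ) (φ : ι → ℝ) :
    ‖∑ c, g c * (Real.sin (φ c) : ℂ)‖ ^ 2 + ‖∑ c, g c * (Real.cos (φ c) : ℂ)‖ ^ 2 =
      (‖∑ c, g c * Complex.exp ((φ c : ℂ) * Complex.I)‖ ^ 2 +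
        ‖∑ c, g c * Complex.exp (((-φ c : ℝ) : ℂ) * Complex.I)‖ ^ 2) / 2 := by
  set S := ∑ c, g c * (Real.sin (φ c) : ℂ) with hS
  set C := ∑ c, g c * (Real.cos (φ c) : ℂ) with hC
  have h1 : ∑ c, g c * Complex.exp ((φ c : ℂ) * Complex.I) = C + Complex.I * S := by
    rw [hS, hC, Finset.mul_sum, ← Finset.sum_add_distrib]
    refine Finset.sum_congr rfl fun c _ => ?_
    rw [Complex.exp_mul_I, Complex.ofReal_sin, Complex.ofReal_cos]
    ring
  have h2 : ∑ c, g c * Complex.exp (((-φ c : ℝ) : ℂ) * Complex.I) = C - Complex.I * S := by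
    rw [hS, hC, Finset.mul_sum, ← Finset.sum_sub_distrib]
    refine Finset.sum_congr rfl fun c _ => ?_
    rw [Complex.exp_mul_I, ← Complex.ofReal_sin, ← Complex.ofReal_cos, Real.sin_neg, Real.cos_neg]
    push_cast
    ring
  have hp := parallelogram_law_with_norm ℝ C (Complex.I * S)
  rw [norm_mul, Complex.norm_I, one_mul] at hp
  rw [h1, h2]
  nlinarith [hp]

/-- For each eigenphase, the squared error times the output weight is bounded by `sum_window_dft`.
The quotient of the sums of squares of increments and of the window gives `5/(2(M²+1))`, which is
below `3/M²`. -/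
theorem window_expectation_le {M : ℕ} (hM : 2 ≤ M) {θ : ℝ} (h0 : 0 ≤ Real.sin θ) :
    ∑ y : Fin M, (ampOutcome M y - Real.sin θ) ^ 2 *
      ((‖∑ c : Fin M, ((window M c : ℂ) * dftRoot M ^ (c * y : ℕ)) *
          (Real.sin ((2 * (c : ℕ) + 1) * θ) : ℂ)‖ ^ 2 +
        ‖∑ c : Fin M, ((window M c : ℂ) * dftRoot M ^ (c * y : ℕ)) *
          (Real.cos ((2 * (c : ℕ) + 1) * θ) : ℂ)‖ ^ 2) /
        (M * ∑ c : Fin M, window M c ^ 2)) ≤ 3 / (M : ℝ) ^ 2 := by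
  have hM' : (2 : ℝ) ≤ M := by exact_mod_cast hM
  -- The `+1` in `(2c+1)θ` contributes only a global phase, which the norm removes.
  have hZ : ∀ (σ : ℝ) (y : Fin M), ‖∑ c : Fin M, ((window M c : ℂ) * dftRoot M ^ (c * y : ℕ)) *
      Complex.exp (((σ * ((2 * (c : ℕ) + 1) * θ) : ℝ) : ℂ) * Complex.I)‖ ^ 2 =
      ‖∑ c : Fin M, (window M c : ℂ) *
        (Complex.exp (((2 * (σ * θ) : ℝ) : ℂ) * Complex.I) * dftRoot M ^ (y : ℕ)) ^ (c : ℕ)‖ ^ 2 := by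
    intro σ y
    have : ∑ c : Fin M, ((window M c : ℂ) * dftRoot M ^ (c * y : ℕ)) *
        Complex.exp (((σ * ((2 * (c : ℕ) + 1) * θ) : ℝ) : ℂ) * Complex.I) =
        Complex.exp (((σ * θ : ℝ) : ℂ) * Complex.I) * ∑ c : Fin M, (window M c : ℂ) *
        (Complex.exp (((2 * (σ * θ) : ℝ) : ℂ) * Complex.I) * dftRoot M ^ (y : ℕ)) ^ (c : ℕ) := by
      rw [Finset.mul_sum]
      refine Finset.sum_congr rfl fun c _ => ?_
      rw [mul_pow, ← Complex.exp_nat_mul, ← pow_mul, mul_comm (y : ℕ)]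
      have : Complex.exp (((σ * ((2 * (c : ℕ) + 1) * θ) : ℝ) : ℂ) * Complex.I) =
          Complex.exp (((σ * θ : ℝ) : ℂ) * Complex.I) *
            Complex.exp ((c : ℕ) * (((2 * (σ * θ) : ℝ) : ℂ) * Complex.I)) := by
        rw [← Complex.exp_add]
        congr 1
        push_cast
        ring
      rw [this]
      ring
    rw [this, norm_mul, Complex.norm_exp_ofReal_mul_I, one_mul]
  have hsum : ∀ σ : ℝ, σ = 1 ∨ σ = -1 → ∑ y : Fin M, (ampOutcome M y - Real.sin θ) ^ 2 *
      ‖∑ c : Fin M, ((window M c : ℂ) * dftRoot M ^ (c * y : ℕ)) *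
        Complex.exp (((σ * ((2 * (c : ℕ) + 1) * θ) : ℝ) : ℂ) * Complex.I)‖ ^ 2 ≤
      M * (M * (M ^ 2 - 1) / 3) / 4 := by
    intro σ hσ
    rw [← sum_window_dft (by omega) (Complex.norm_exp_ofReal_mul_I (2 * (σ * θ))),
      Finset.sum_div]
    refine Finset.sum_le_sum fun y _ => ?_
    rw [hZ]
    calc _ ≤ _ := mul_le_mul_of_nonneg_right (ampOutcome_sub_sq_le y h0 σ hσ) (by positivity)
      _ = _ := by ring
  have hp := hsum 1 (Or.inl rfl)
  have hm := hsum (-1) (Or.inr rfl)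
  have hW : 0 < (M : ℝ) * ((M : ℝ) * (M ^ 4 - 1) / 30) := by
    have : (1 : ℝ) < M ^ 4 := one_lt_pow₀ (by linarith) (by norm_num)
    have : 0 < (M : ℝ) ^ 4 - 1 := by linarith
    positivity
  simp only [norm_sq_add_norm_sq_rotate, sum_window_sq]
  simp only [one_mul, neg_one_mul] at hp hm
  calc _ = (∑ y : Fin M, (ampOutcome M y - Real.sin θ) ^ 2 *
      ‖∑ c : Fin M, ((window M c : ℂ) * dftRoot M ^ (c * y : ℕ)) *
        Complex.exp ((((2 * (c : ℕ) + 1) * θ : ℝ) : ℂ) * Complex.I)‖ ^ 2 +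
      ∑ y : Fin M, (ampOutcome M y - Real.sin θ) ^ 2 *
      ‖∑ c : Fin M, ((window M c : ℂ) * dftRoot M ^ (c * y : ℕ)) *
        Complex.exp (((-((2 * (c : ℕ) + 1) * θ) : ℝ) : ℂ) * Complex.I)‖ ^ 2) / 2 /
        ((M : ℝ) * ((M : ℝ) * (M ^ 4 - 1) / 30)) := by
        rw [← Finset.sum_add_distrib, Finset.sum_div, Finset.sum_div]
        refine Finset.sum_congr rfl fun y _ => ?_
        ring
    _ ≤ (M * (M * (M ^ 2 - 1) / 3) / 4) / ((M : ℝ) * ((M : ℝ) * (M ^ 4 - 1) / 30)) := by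
        apply div_le_div_of_nonneg_right _ hW.le
        linarith
    _ ≤ _ := by
        rw [div_le_div_iff₀ hW (by positivity)]
        have h1 : 0 ≤ (M : ℝ) ^ 2 * ((M : ℝ) ^ 2 - 1) := by
          have : (1 : ℝ) ≤ (M : ℝ) ^ 2 := one_le_pow₀ (by linarith)
          have : 0 ≤ (M : ℝ) ^ 2 - 1 := by linarith
          positivity
        nlinarith [mul_nonneg h1 (sq_nonneg (M : ℝ))]

/-! ### Amplitude estimation -/

/-- Unitarity of the reflection `2|u⟩⟨u| - 1` about the uniform unit vector `u`. -/
theorem sum_norm_sq_reflection {X : Type*} [Fintype X] [Nonempty X] (ψ : X → ℂ) :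
    ∑ x, ‖2 / (Fintype.card X : ℂ) * ∑ x', ψ x' - ψ x‖ ^ 2 = ∑ x, ‖ψ x‖ ^ 2 := by
  have hK : (Fintype.card X : ℂ) ≠ 0 := by exact_mod_cast Fintype.card_ne_zero
  set S := ∑ x', ψ x' with hS
  set K : ℂ := (Fintype.card X : ℂ) with hKdef
  have key : ∑ x, (2 / K * S - ψ x) * (starRingEnd ℂ) (2 / K * S - ψ x) =
      ∑ x, ψ x * (starRingEnd ℂ) (ψ x) := by
    have h1 : ∀ x, (2 / K * S - ψ x) * (starRingEnd ℂ) (2 / K * S - ψ x) =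
        2 / K * S * (starRingEnd ℂ) (2 / K * S) - 2 / K * S * (starRingEnd ℂ) (ψ x) -
        (starRingEnd ℂ) (2 / K * S) * ψ x + ψ x * (starRingEnd ℂ) (ψ x) := fun x => by
      rw [map_sub]; ring
    simp only [h1, Finset.sum_add_distrib, Finset.sum_sub_distrib, ← Finset.mul_sum, ← map_sum,
      Finset.sum_const, Finset.card_univ, nsmul_eq_mul, ← hS, ← hKdef]
    have h2 : (starRingEnd ℂ) K = K := by simp [hKdef]
    simp only [map_mul, map_div₀, h2, map_ofNat]
    field_simp
    ring
  simp only [Complex.mul_conj, Complex.normSq_eq_norm_sq] at key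
  exact_mod_cast key

section AmplitudeEstimation

variable {n m R M : ℕ}

/-- The register that is searched, a point of `[n]` and a label in `[R]`, is combined with a
counter. -/
theorem sum_basisState (F : BasisState n m (Fin R × Fin M) → ℝ) :
    ∑ s, F s = ∑ b, ∑ c, ∑ p : Fin n × Fin R, F (p.1, b, p.2, c) := by
  simp only [Fintype.sum_prod_type]
  rw [Finset.sum_comm]
  refine Finset.sum_congr rfl fun b _ => ?_
  rw [Finset.sum_comm (s := (Finset.univ : Finset (Fin M)))]
  refine Finset.sum_congr rfl fun x _ => ?_
  rw [Finset.sum_comm]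

open Classical in
/-- Change the sign if the answer register marks the label and the counter exceeds `j`. -/
noncomputable def signLin (G : Fin m → Fin R → Prop) (j : ℕ) :
    (BasisState n m (Fin R × Fin M) → ℂ) →ₗ[ℂ] (BasisState n m (Fin R × Fin M) → ℂ) where
  toFun ψ s := (if j < (s.2.2.2 : ℕ) ∧ ∃ y, encodeBits y = s.2.1 ∧ G y s.2.2.1 then -1 else 1) * ψ s
  map_add' ψ φ := by funext s; simp only [Pi.add_apply]; ring
  map_smul' c ψ := by
    funext s; simp only [Pi.smul_apply, smul_eq_mul, RingHom.id_apply]; ring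

theorem normPreserving_signLin (G : Fin m → Fin R → Prop) (j : ℕ) :
    NormPreserving (signLin (n := n) (M := M) G j) := fun ψ => by
  refine Finset.sum_congr rfl fun s _ => ?_
  simp only [signLin, LinearMap.coe_mk, AddHom.coe_mk, norm_mul]
  split_ifs <;> simp

/-- Reflect the searched register about the uniform superposition if the counter exceeds `j`. -/
noncomputable def diffusionLin (j : ℕ) :
    (BasisState n m (Fin R × Fin M) → ℂ) →ₗ[ℂ] (BasisState n m (Fin R × Fin M) → ℂ) where
  toFun ψ s := if j < (s.2.2.2 : ℕ) then
      2 / (Fintype.card (Fin n × Fin R) : ℂ) *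
        ∑ p : Fin n × Fin R, ψ (p.1, s.2.1, p.2, s.2.2.2) - ψ s
    else ψ s
  map_add' ψ φ := by
    funext s
    simp only [Pi.add_apply, Finset.sum_add_distrib]
    split_ifs
    · ring
    · rfl
  map_smul' c ψ := by
    funext s
    simp only [Pi.smul_apply, smul_eq_mul, RingHom.id_apply, ← Finset.mul_sum]
    split_ifs
    · ring
    · rfl

theorem normPreserving_diffusionLin (hn : 0 < n) (hR : 0 < R) (j : ℕ) :
    NormPreserving (diffusionLin (n := n) (m := m) (R := R) (M := M) j) := fun ψ => by
  have : Nonempty (Fin n × Fin R) := ⟨(⟨0, hn⟩, ⟨0, hR⟩)⟩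
  rw [stateNormSq, stateNormSq, sum_basisState, sum_basisState]
  refine Finset.sum_congr rfl fun b _ => Finset.sum_congr rfl fun c _ => ?_
  by_cases h : j < (c : ℕ)
  · simp only [diffusionLin, LinearMap.coe_mk, AddHom.coe_mk, h, if_true]
    exact sum_norm_sq_reflection (fun p : Fin n × Fin R => ψ (p.1, b, p.2, c))
  · simp only [diffusionLin, LinearMap.coe_mk, AddHom.coe_mk, h, if_false]

/-- The discrete Fourier transform of the counter. -/
noncomputable def dftLin :
    (BasisState n m (Fin R × Fin M) → ℂ) →ₗ[ℂ] (BasisState n m (Fin R × Fin M) → ℂ) where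
  toFun ψ s := (Real.sqrt M : ℂ)⁻¹ *
    ∑ c : Fin M, dftRoot M ^ (c * s.2.2.2 : ℕ) * ψ (s.1, s.2.1, s.2.2.1, c)
  map_add' ψ φ := by
    funext s
    simp only [Pi.add_apply, mul_add, Finset.sum_add_distrib]
  map_smul' a ψ := by
    funext s
    simp only [Pi.smul_apply, smul_eq_mul, RingHom.id_apply, Finset.mul_sum]
    exact Finset.sum_congr rfl fun c _ => by ring

theorem normPreserving_dftLin (hM : 0 < M) :
    NormPreserving (dftLin (n := n) (m := m) (R := R) (M := M)) := fun ψ => by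
  have hM' : (M : ℝ) ≠ 0 := by exact_mod_cast hM.ne'
  rw [stateNormSq, stateNormSq, sum_basisState, sum_basisState]
  refine Finset.sum_congr rfl fun b _ => ?_
  rw [Finset.sum_comm, Finset.sum_comm (s := (Finset.univ : Finset (Fin M)))]
  refine Finset.sum_congr rfl fun p _ => ?_
  simp only [dftLin, LinearMap.coe_mk, AddHom.coe_mk, norm_mul, mul_pow, norm_inv,
    Complex.norm_real, Real.norm_eq_abs, sq_abs, inv_pow, Real.sq_sqrt (Nat.cast_nonneg M)]
  rw [← Finset.mul_sum, sum_norm_sq_dft hM, ← mul_assoc, inv_mul_cancel₀ hM', one_mul]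

open Classical in
/-- The fraction of marked points. -/
noncomputable def markedFraction (G : Fin m → Fin R → Prop) (f : Fin n → Fin m) : ℝ :=
  ((Finset.univ.filter fun p : Fin n × Fin R => G (f p.1) p.2).card : ℝ) / (n * R)

open Classical in
/-- The state of amplitude estimation after `j` rounds. -/
noncomputable def ampState (G : Fin m → Fin R → Prop) (f : Fin n → Fin m) (j : ℕ) :
    BasisState n m (Fin R × Fin M) → ℂ := fun s =>
  if s.2.1 = (fun _ => false) then
    (((Real.sqrt (n * R))⁻¹ * (Real.sqrt (∑ c : Fin M, window M c ^ 2))⁻¹ * window M s.2.2.2 *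
      (if G (f s.1) s.2.2.1 then (groverAmp (markedFraction G f) (min s.2.2.2 j)).1
        else (groverAmp (markedFraction G f) (min s.2.2.2 j)).2) : ℝ) : ℂ)
  else 0

theorem sum_ite_marked (hn : 0 < n) (hR : 0 < R) (G : Fin m → Fin R → Prop) (f : Fin n → Fin m)
    [∀ p : Fin n × Fin R, Decidable (G (f p.1) p.2)] (α β : ℝ) :
    ∑ p : Fin n × Fin R, (if G (f p.1) p.2 then α else β) =
      n * R * (markedFraction G f * α + (1 - markedFraction G f) * β) := by
  have hn' : (n : ℝ) ≠ 0 := by exact_mod_cast hn.ne'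
  have hR' : (R : ℝ) ≠ 0 := by exact_mod_cast hR.ne'
  have hc := Finset.card_filter_add_card_filter_not
    (s := (Finset.univ : Finset (Fin n × Fin R))) (fun p => G (f p.1) p.2)
  rw [Finset.card_univ, Fintype.card_prod, Fintype.card_fin, Fintype.card_fin] at hc
  have hc' : ((Finset.univ.filter fun p : Fin n × Fin R => G (f p.1) p.2).card : ℝ) +
      ((Finset.univ.filter fun p : Fin n × Fin R => ¬ G (f p.1) p.2).card : ℝ) = n * R := by
    exact_mod_cast hc
  have hmf : markedFraction G f =
      ((Finset.univ.filter fun p : Fin n × Fin R => G (f p.1) p.2).card : ℝ) / (n * R) := by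
    unfold markedFraction
    congr!
  rw [Finset.sum_ite, Finset.sum_const, Finset.sum_const, nsmul_eq_mul, nsmul_eq_mul, hmf,
    eq_sub_of_add_eq' hc']
  field_simp

/-- Compute, apply the phase, uncompute: the first call writes `f(x)` into the zero answer register
and the second call erases it. Thus a round costs two queries. -/
theorem oracle_sign_oracle (G : Fin m → Fin R → Prop) [∀ y r, Decidable (G y r)]
    (f : Fin n → Fin m) (j : ℕ)
    (ψ : BasisState n m (Fin R × Fin M) → ℂ) (x : Fin n) (r : Fin R) (c : Fin M) :
    oracle f (signLin G j (oracle f ψ)) (x, (fun _ => false), r, c) =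
      (if j < (c : ℕ) ∧ G (f x) r then -1 else 1) * ψ (x, (fun _ => false), r, c) := by
  have hinv := oracleShift_involutive f ((x, (fun _ => false), r, c) : BasisState n m (Fin R × Fin M))
  simp only [oracle, signLin, LinearMap.coe_mk, AddHom.coe_mk]
  rw [hinv]
  congr 1
  have h : (∃ y, encodeBits y = (oracleShift f
      ((x, (fun _ => false), r, c) : BasisState n m (Fin R × Fin M))).2.1 ∧ G y r) ↔ G (f x) r := by
    have he : (oracleShift f ((x, (fun _ => false), r, c) :
        BasisState n m (Fin R × Fin M))).2.1 = encodeBits (f x) := by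
      funext k; simp [oracleShift]
    rw [he]
    constructor
    · rintro ⟨y, hy, hG⟩
      rwa [← encodeBits_injective hy]
    · exact fun hG => ⟨f x, rfl, hG⟩
  have hiff : (j < (c : ℕ) ∧ ∃ y, encodeBits y = (oracleShift f
      ((x, (fun _ => false), r, c) : BasisState n m (Fin R × Fin M))).2.1 ∧ G y r) ↔
      (j < (c : ℕ) ∧ G (f x) r) := and_congr Iff.rfl h
  by_cases hh : j < (c : ℕ) ∧ G (f x) r
  · rw [if_pos hh]
    exact if_pos (hiff.mpr hh)
  · rw [if_neg hh]
    exact if_neg fun h' => hh (hiff.mp h')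

theorem oracle_sign_oracle_eq_zero (G : Fin m → Fin R → Prop) (f : Fin n → Fin m) (j : ℕ)
    (ψ : BasisState n m (Fin R × Fin M) → ℂ) (s : BasisState n m (Fin R × Fin M))
    (h : ψ s = 0) : oracle f (signLin G j (oracle f ψ)) s = 0 := by
  simp only [oracle, signLin, LinearMap.coe_mk, AddHom.coe_mk]
  rw [oracleShift_involutive f s, h, mul_zero]

/-- The amplitudes take one value on marked and one on unmarked points, so their mean depends only
on the marked fraction and the reflection becomes the recursion of `groverAmp`. A counter `c ≤ j` is
left alone, whence the minimum in `ampState`. -/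
theorem ampState_succ (hn : 0 < n) (hR : 0 < R) (G : Fin m → Fin R → Prop) (f : Fin n → Fin m)
    (j : ℕ) :
    diffusionLin j (oracle f (signLin G j (oracle f (ampState (M := M) G f j)))) =
      ampState G f (j + 1) := by
  classical
  have hn' : (n : ℝ) ≠ 0 := by exact_mod_cast hn.ne'
  have hR' : (R : ℝ) ≠ 0 := by exact_mod_cast hR.ne'
  funext ⟨x, b, r, c⟩
  by_cases hb : b = (fun _ => false)
  · subst hb
    simp only [diffusionLin, LinearMap.coe_mk, AddHom.coe_mk]
    simp only [oracle_sign_oracle]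
    by_cases hj : j < (c : ℕ)
    · simp only [hj, if_true, true_and]
      have h1 : min (c : ℕ) j = j := by omega
      have h2 : min (c : ℕ) (j + 1) = j + 1 := by omega
      simp only [ampState, if_true, h1, h2]
      set A := (Real.sqrt (n * R))⁻¹ * (Real.sqrt (∑ c : Fin M, window M c ^ 2))⁻¹ * window M c
        with hA
      set g := groverAmp (markedFraction G f) j with hg
      have e : ∀ p : Fin n × Fin R, (if G (f p.1) p.2 then (-1 : ℂ) else 1) *
          ((A * (if G (f p.1) p.2 then g.1 else g.2) : ℝ) : ℂ) =
          ((A * (if G (f p.1) p.2 then -g.1 else g.2) : ℝ) : ℂ) := by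
        intro p
        split_ifs <;> push_cast <;> ring
      simp only [e]
      rw [e (x, r)]
      have hs : ∑ p : Fin n × Fin R, A * (if G (f p.1) p.2 then -g.1 else g.2) =
          A * (n * R * (markedFraction G f * (-g.1) + (1 - markedFraction G f) * g.2)) := by
        rw [← Finset.mul_sum, sum_ite_marked hn hR]
      rw [← Complex.ofReal_sum, hs, Fintype.card_prod, Fintype.card_fin, Fintype.card_fin]
      have h3 : (2 : ℂ) / ((n * R : ℕ) : ℂ) = ((2 / (n * R) : ℝ) : ℂ) := by push_cast; rfl
      rw [h3, ← Complex.ofReal_mul, ← Complex.ofReal_sub]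
      congr 1
      simp only [groverAmp, ← hg]
      split_ifs <;> field_simp <;> ring
    · simp only [hj, if_false, false_and, one_mul]
      have h1 : min (c : ℕ) j = c := by omega
      have h2 : min (c : ℕ) (j + 1) = c := by omega
      simp only [ampState, h1, h2]
  · have hz : ∀ (x : Fin n) (r : Fin R) (c : Fin M),
        oracle f (signLin G j (oracle f (ampState (M := M) G f j))) (x, b, r, c) = 0 :=
      fun x r c => oracle_sign_oracle_eq_zero _ _ _ _ _ (by simp [ampState, hb])
    simp only [diffusionLin, LinearMap.coe_mk, AddHom.coe_mk, hz]
    simp [ampState, hb]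

end AmplitudeEstimation

theorem runState_congr {n m : ℕ} {W : Type} [DecidableEq W]
    {step step' : ℕ → (BasisState n m W → ℂ) →ₗ[ℂ] (BasisState n m W → ℂ)} (i : BasisState n m W)
    (f : Fin n → Fin m) (k : ℕ) (h : ∀ j ≤ k, step j = step' j) :
    runState step i f k = runState step' i f k := by
  induction k with
  | zero => rw [runState, runState, h 0 le_rfl]
  | succ k ih => rw [runState, runState, h _ le_rfl, ih fun j hj => h j (by omega)]

theorem runState_comp_last {n m : ℕ} {W : Type} [DecidableEq W]
    (step : ℕ → (BasisState n m W → ℂ) →ₗ[ℂ] (BasisState n m W → ℂ))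
    (L : (BasisState n m W → ℂ) →ₗ[ℂ] (BasisState n m W → ℂ)) (i : BasisState n m W)
    (f : Fin n → Fin m) (T : ℕ) :
    runState (fun k => if k = T then L ∘ₗ step k else step k) i f T = L (runState step i f T) := by
  cases T with
  | zero => simp [runState]
  | succ k =>
    rw [runState, runState, if_pos rfl, LinearMap.comp_apply]
    rw [runState_congr i f k (step' := step) fun j hj => if_neg (by omega)]

section AmplitudeEstimation

variable {n m R M : ℕ}

/-- The unitaries of amplitude estimation before the Fourier transform; `L` prepares the initial
superposition. -/
noncomputable def ampStep (G : Fin m → Fin R → Prop)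
    (L : (BasisState n m (Fin R × Fin M) → ℂ) →ₗ[ℂ] (BasisState n m (Fin R × Fin M) → ℂ)) :
    ℕ → (BasisState n m (Fin R × Fin M) → ℂ) →ₗ[ℂ] (BasisState n m (Fin R × Fin M) → ℂ)
  | 0 => L
  | k + 1 => if k % 2 = 0 then signLin G (k / 2) else diffusionLin (k / 2)

theorem runState_ampStep (hn : 0 < n) (hR : 0 < R) (G : Fin m → Fin R → Prop)
    (L : (BasisState n m (Fin R × Fin M) → ℂ) →ₗ[ℂ] (BasisState n m (Fin R × Fin M) → ℂ))
    (i : BasisState n m (Fin R × Fin M)) (f : Fin n → Fin m)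
    (hL : L (Pi.single i 1) = ampState G f 0) (j : ℕ) :
    runState (ampStep G L) i f (2 * j) = ampState G f j := by
  induction j with
  | zero => exact hL
  | succ j ih =>
    have h1 : (2 * j) % 2 = 0 := by omega
    have h2 : (2 * j) / 2 = j := by omega
    have h3 : ¬ (2 * j + 1) % 2 = 0 := by omega
    have h4 : (2 * j + 1) / 2 = j := by omega
    rw [show 2 * (j + 1) = 2 * j + 1 + 1 by ring, runState, runState, ih, ampStep, ampStep,
      if_pos h1, if_neg h3, h2, h4, ampState_succ hn hR]

theorem stateNormSq_ampState_zero (hn : 0 < n) (hR : 0 < R) (hM : 2 ≤ M) (G : Fin m → Fin R → Prop)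
    (f : Fin n → Fin m) : stateNormSq (ampState (M := M) G f 0) = 1 := by
  have hn' : (0 : ℝ) < n := by exact_mod_cast hn
  have hR' : (0 : ℝ) < R := by exact_mod_cast hR
  have hM' : (2 : ℝ) ≤ M := by exact_mod_cast hM
  have hW : 0 < ∑ c : Fin M, window M c ^ 2 := by
    rw [sum_window_sq]
    have : (1 : ℝ) < M ^ 4 := one_lt_pow₀ (by linarith) (by norm_num)
    have : 0 < (M : ℝ) ^ 4 - 1 := by linarith
    positivity
  rw [stateNormSq, sum_basisState, Finset.sum_eq_single (fun _ => false)]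
  · simp only [ampState, if_true, Nat.min_zero, groverAmp, ite_self, mul_one, Complex.norm_real,
      Real.norm_eq_abs, sq_abs, mul_pow, inv_pow, Real.sq_sqrt hW.le,
      Real.sq_sqrt (mul_pos hn' hR').le, Finset.sum_const, Finset.card_univ, Fintype.card_prod,
      Fintype.card_fin, nsmul_eq_mul]
    rw [← Finset.mul_sum, ← Finset.mul_sum]
    push_cast
    field_simp
  · intro b _ hb
    simp [ampState, hb]
  · simp

/-- Marked points carry total weight `a = sin² θ` and unmarked ones `1 - a = cos² θ`; these factors
turn relative amplitudes into the sine and cosine sums. -/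
theorem sum_dftLin_ampState (hn : 0 < n) (hR : 0 < R) (G : Fin m → Fin R → Prop)
    (f : Fin n → Fin m) (φ : Fin M → ℝ) {θ : ℝ} (hθ : Real.sin θ ^ 2 = markedFraction G f) :
    ∑ s, ‖dftLin (ampState (M := M) G f M) s‖ ^ 2 * φ s.2.2.2 =
      ∑ y : Fin M, φ y *
      ((‖∑ c : Fin M, ((window M c : ℂ) * dftRoot M ^ (c * y : ℕ)) *
          (Real.sin ((2 * (c : ℕ) + 1) * θ) : ℂ)‖ ^ 2 +
        ‖∑ c : Fin M, ((window M c : ℂ) * dftRoot M ^ (c * y : ℕ)) *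
          (Real.cos ((2 * (c : ℕ) + 1) * θ) : ℂ)‖ ^ 2) /
        (M * ∑ c : Fin M, window M c ^ 2)) := by
  classical
  have hn' : (0 : ℝ) < n := by exact_mod_cast hn
  have hR' : (0 : ℝ) < R := by exact_mod_cast hR
  have hW : 0 ≤ ∑ c : Fin M, window M c ^ 2 := Finset.sum_nonneg fun c _ => sq_nonneg _
  set W := ∑ c : Fin M, window M c ^ 2 with hWdef
  rw [sum_basisState, Finset.sum_eq_single (fun _ => false)]
  · refine Finset.sum_congr rfl fun y _ => ?_
    set α : ℂ := ∑ c : Fin M, ((window M c : ℂ) * dftRoot M ^ (c * y : ℕ)) *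
      ((groverAmp (markedFraction G f) c).1 : ℂ) with hα
    set β : ℂ := ∑ c : Fin M, ((window M c : ℂ) * dftRoot M ^ (c * y : ℕ)) *
      ((groverAmp (markedFraction G f) c).2 : ℂ) with hβ
    have hamp : ∀ p : Fin n × Fin R,
        ‖dftLin (ampState (M := M) G f M) (p.1, (fun _ => false), p.2, y)‖ ^ 2 * φ y =
        if G (f p.1) p.2 then φ y * (‖α‖ ^ 2 / (M * W * (n * R)))
          else φ y * (‖β‖ ^ 2 / (M * W * (n * R))) := by
      intro p
      have : dftLin (ampState (M := M) G f M) (p.1, (fun _ => false), p.2, y) =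
          (((Real.sqrt M)⁻¹ * ((Real.sqrt (n * R))⁻¹ * (Real.sqrt W)⁻¹) : ℝ) : ℂ) *
            (if G (f p.1) p.2 then α else β) := by
        simp only [dftLin, LinearMap.coe_mk, AddHom.coe_mk, ampState, if_true]
        rw [Complex.ofReal_mul, Complex.ofReal_inv, mul_assoc]
        congr 1
        -- After `M` rounds every counter value `c < M` has received exactly its `c` rotations.
        have hmin : ∀ c : Fin M, min (c : ℕ) M = c := fun c => by omega
        split_ifs
        all_goals
          rw [Finset.mul_sum]
          refine Finset.sum_congr rfl fun c _ => ?_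
          rw [hmin]
          push_cast
          ring
      rw [this, norm_mul, mul_pow, Complex.norm_real, Real.norm_eq_abs, sq_abs, mul_pow, mul_pow,
        inv_pow, inv_pow, inv_pow, Real.sq_sqrt (Nat.cast_nonneg M), Real.sq_sqrt hW,
        Real.sq_sqrt (mul_pos hn' hR').le]
      split_ifs <;> field_simp
    simp only [hamp]
    rw [sum_ite_marked hn hR]
    have hs : ‖∑ c : Fin M, ((window M c : ℂ) * dftRoot M ^ (c * y : ℕ)) *
        (Real.sin ((2 * (c : ℕ) + 1) * θ) : ℂ)‖ ^ 2 = markedFraction G f * ‖α‖ ^ 2 := by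
      have : ∑ c : Fin M, ((window M c : ℂ) * dftRoot M ^ (c * y : ℕ)) *
          (Real.sin ((2 * (c : ℕ) + 1) * θ) : ℂ) = (Real.sin θ : ℂ) * α := by
        rw [hα, Finset.mul_sum]
        refine Finset.sum_congr rfl fun c _ => ?_
        rw [← (groverAmp_eq θ c).1, hθ]
        push_cast
        ring
      rw [this, norm_mul, mul_pow, Complex.norm_real, Real.norm_eq_abs, sq_abs, hθ]
    have hc : ‖∑ c : Fin M, ((window M c : ℂ) * dftRoot M ^ (c * y : ℕ)) *
        (Real.cos ((2 * (c : ℕ) + 1) * θ) : ℂ)‖ ^ 2 = (1 - markedFraction G f) * ‖β‖ ^ 2 := by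
      have : ∑ c : Fin M, ((window M c : ℂ) * dftRoot M ^ (c * y : ℕ)) *
          (Real.cos ((2 * (c : ℕ) + 1) * θ) : ℂ) = (Real.cos θ : ℂ) * β := by
        rw [hβ, Finset.mul_sum]
        refine Finset.sum_congr rfl fun c _ => ?_
        rw [← (groverAmp_eq θ c).2, hθ]
        push_cast
        ring
      rw [this, norm_mul, mul_pow, Complex.norm_real, Real.norm_eq_abs, sq_abs, Real.cos_sq', hθ]
    rw [hs, hc]
    field_simp
  · intro b _ hb
    simp [dftLin, ampState, hb]
  · simp

theorem markedFraction_nonneg (G : Fin m → Fin R → Prop) (f : Fin n → Fin m) :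
    0 ≤ markedFraction G f := by
  unfold markedFraction; positivity

theorem markedFraction_le_one (G : Fin m → Fin R → Prop) (f : Fin n → Fin m) :
    markedFraction G f ≤ 1 := by
  classical
  unfold markedFraction
  apply div_le_one_of_le₀ _ (by positivity)
  have := Finset.card_filter_le (Finset.univ : Finset (Fin n × Fin R)) (fun p => G (f p.1) p.2)
  rw [Finset.card_univ, Fintype.card_prod, Fintype.card_fin, Fintype.card_fin] at this
  exact_mod_cast this

/-- Amplitude estimation: `2 M` queries suffice to estimate the square root of the fraction of
marked points with mean squared error `O(1 / M²)`. -/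
theorem exists_amplitudeEstimation (hn : 0 < n) (hm : 0 < m) (hR : 0 < R) (hM : 2 ≤ M)
    (G : Fin m → Fin R → Prop) :
    ∃ A : Experiment n m ℝ, A.queries = 2 * M ∧
      ∀ f, A.expect f (fun r => (r - Real.sqrt (markedFraction G f)) ^ 2) ≤ 3 / (M : ℝ) ^ 2 := by
  let i : BasisState n m (Fin R × Fin M) :=
    (⟨0, hn⟩, fun _ => false, ⟨0, hR⟩, ⟨0, by omega⟩)
  let f₀ : Fin n → Fin m := fun _ => ⟨0, hm⟩
  obtain ⟨L, hL, hLi⟩ := exists_normPreserving_single i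
    (stateNormSq_ampState_zero (M := M) hn hR hM G f₀)
  -- Before the first round marked and unmarked amplitudes agree, so a state prepared for one `f₀`
  -- serves every `f`.
  have hLf : ∀ f, L (Pi.single i 1) = ampState G f 0 := fun f => by
    rw [hLi]
    funext s
    simp [ampState, groverAmp]
  have hstep : ∀ k, NormPreserving (ampStep G L k) := by
    rintro (_ | k)
    · exact hL
    · rw [ampStep]
      split_ifs
      · exact normPreserving_signLin G _
      · exact normPreserving_diffusionLin hn hR _
  let A : Experiment n m ℝ :=
    { queries := 2 * M
      Work := Fin R × Fin M
      init := i
      step := fun k => if k = 2 * M then dftLin ∘ₗ ampStep G L k else ampStep G L k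
      normPreserving_step := fun k => by
        split_ifs
        · exact (normPreserving_dftLin (by omega)).comp (hstep k)
        · exact hstep k
      outcome := fun s => ampOutcome M s.2.2.2 }
  refine ⟨A, rfl, fun f => ?_⟩
  have hstate : A.state f A.queries = dftLin (ampState G f M) := by
    change runState _ i f (2 * M) = _
    rw [runState_comp_last, runState_ampStep hn hR G L i f (hLf f)]
  set a := markedFraction G f with ha
  have ha0 : 0 ≤ a := markedFraction_nonneg G f
  have hsin : Real.sin (Real.arcsin (Real.sqrt a)) = Real.sqrt a :=
    Real.sin_arcsin (by linarith [Real.sqrt_nonneg a])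
      (Real.sqrt_le_one.mpr (markedFraction_le_one G f))
  have hsum := sum_dftLin_ampState hn hR G f
    (fun y : Fin M => (ampOutcome M y - Real.sin (Real.arcsin (Real.sqrt a))) ^ 2)
    (θ := Real.arcsin (Real.sqrt a)) (by rw [hsin, Real.sq_sqrt ha0])
  have hw := window_expectation_le hM (θ := Real.arcsin (Real.sqrt a))
    (by rw [hsin]; exact Real.sqrt_nonneg a)
  rw [← hsum, hsin] at hw
  rw [Experiment.expect, hstate]
  exact hw

end AmplitudeEstimation

/-! ### Bernoulli samples and the set of their values -/

section Bernoulli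

variable {X Y : Type*} [Fintype X] [DecidableEq X] [Fintype Y] [DecidableEq Y]

/-- The probability that a random subset, which contains every point independently with
probability `p`, equals `S`. -/
noncomputable def bernoulliWeight (p : ℝ) (S : Finset X) : ℝ :=
  p ^ S.card * (1 - p) ^ Sᶜ.card

theorem bernoulliWeight_nonneg {p : ℝ} (h0 : 0 ≤ p) (h1 : p ≤ 1) (S : Finset X) :
    0 ≤ bernoulliWeight p S := by
  have : 0 ≤ 1 - p := by linarith
  unfold bernoulliWeight; positivity

theorem sum_bernoulliWeight_mul_prod (p : ℝ) (a : X → ℝ) :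
    ∑ S, bernoulliWeight p S * ∏ x ∈ S, a x = ∏ x, (p * a x + (1 - p)) := by
  rw [Finset.prod_add, Finset.powerset_univ]
  refine Finset.sum_congr rfl fun S _ => ?_
  rw [Finset.prod_mul_distrib, Finset.prod_const, Finset.prod_const, bernoulliWeight,
    ← Finset.compl_eq_univ_sdiff]
  ring

theorem sum_bernoulliWeight (p : ℝ) : ∑ S : Finset X, bernoulliWeight p S = 1 := by
  simpa using sum_bernoulliWeight_mul_prod (X := X) p (fun _ => 1)

/-- Apply the product formula to the indicator of the complement of `B`. -/
theorem sum_bernoulliWeight_disjoint (p : ℝ) (B : Finset X) :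
    ∑ S, bernoulliWeight p S * (if Disjoint S B then 1 else 0) = (1 - p) ^ B.card := by
  have h := sum_bernoulliWeight_mul_prod p (fun x => if x ∈ B then (0 : ℝ) else 1)
  have h1 : ∀ S : Finset X, ∏ x ∈ S, (if x ∈ B then (0 : ℝ) else 1) =
      if Disjoint S B then 1 else 0 := by
    intro S
    split_ifs with hS
    · exact Finset.prod_eq_one fun x hx => if_neg (Finset.disjoint_left.mp hS hx)
    · rw [Finset.not_disjoint_iff] at hS
      obtain ⟨x, hx, hB⟩ := hS
      exact Finset.prod_eq_zero hx (if_pos hB)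
  have h2 : ∏ x : X, (p * (if x ∈ B then (0 : ℝ) else 1) + (1 - p)) = (1 - p) ^ B.card := by
    have : ∀ x : X, p * (if x ∈ B then (0 : ℝ) else 1) + (1 - p) = if x ∈ B then 1 - p else 1 := by
      intro x; split_ifs <;> ring
    simp only [this]
    rw [Finset.prod_ite_mem, Finset.univ_inter, Finset.prod_const]
  rw [← h2, ← h]
  simp only [h1]

theorem sum_bernoulliWeight_mul_card (p : ℝ) :
    ∑ S : Finset X, bernoulliWeight p S * (S.card : ℝ) = p * Fintype.card X := by
  have h1 : ∀ S : Finset X, (S.card : ℝ) =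
      ∑ x : X, (1 - if Disjoint S {x} then (1 : ℝ) else 0) := by
    intro S
    have : ∀ x : X, (1 - if Disjoint S {x} then (1 : ℝ) else 0) = if x ∈ S then 1 else 0 := by
      intro x
      by_cases h : x ∈ S <;> simp [h]
    simp only [this]
    simp
  simp only [h1, Finset.mul_sum, mul_sub, mul_one]
  rw [Finset.sum_comm]
  simp only [Finset.sum_sub_distrib, sum_bernoulliWeight, sum_bernoulliWeight_disjoint]
  simp
  ring

/-- The events that the values of `g` on the random set contain `j` are independent. -/
theorem sum_bernoulliWeight_image (p : ℝ) (g : X → Y) (z : Y → ℝ) :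
    ∑ S, bernoulliWeight p S * ∏ j ∈ S.image g, z j =
      ∏ j, ((1 - p) ^ (Finset.univ.filter fun x => g x = j).card +
        (1 - (1 - p) ^ (Finset.univ.filter fun x => g x = j).card) * z j) := by
  set F : Y → Finset X := fun j => Finset.univ.filter fun x => g x = j with hF
  -- Each factor becomes affine in the indicator that `S` misses a fibre. Expanding over sets `A` of
  -- values leaves the probability of missing a disjoint union of fibres, which multiplies.
  have hprod : ∀ S : Finset X, ∏ j ∈ S.image g, z j =
      ∏ j, ((1 - z j) * (if Disjoint S (F j) then 1 else 0) + z j) := by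
    intro S
    rw [← Finset.univ_inter (S.image g), ← Finset.prod_ite_mem]
    refine Finset.prod_congr rfl fun j _ => ?_
    have : j ∈ S.image g ↔ ¬ Disjoint S (F j) := by
      rw [Finset.not_disjoint_iff, Finset.mem_image]
      simp [hF]
    by_cases h : Disjoint S (F j) <;> simp [this, h]
  have hdis : ∀ (S : Finset X) (A : Finset Y),
      ∏ j ∈ A, (if Disjoint S (F j) then (1 : ℝ) else 0) =
        if Disjoint S (A.biUnion F) then 1 else 0 := by
    intro S A
    split_ifs with h
    · rw [Finset.disjoint_biUnion_right] at h
      exact Finset.prod_eq_one fun j hj => if_pos (h j hj)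
    · rw [Finset.disjoint_biUnion_right] at h
      push Not at h
      obtain ⟨j, hj, h⟩ := h
      exact Finset.prod_eq_zero hj (if_neg h)
  have hcard : ∀ A : Finset Y, (A.biUnion F).card = ∑ j ∈ A, (F j).card := fun A =>
    Finset.card_biUnion fun i _ j _ hij => by
      refine Finset.disjoint_left.mpr fun x hx hx' => ?_
      simp only [hF, Finset.mem_filter, Finset.mem_univ, true_and] at hx hx'
      exact hij (hx.symm.trans hx')
  have hR : ∀ j, (1 - p) ^ (F j).card + (1 - (1 - p) ^ (F j).card) * z j =
      (1 - z j) * (1 - p) ^ (F j).card + z j := fun j => by ring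
  change _ = ∏ j, ((1 - p) ^ (F j).card + (1 - (1 - p) ^ (F j).card) * z j)
  simp only [hR, hprod, Finset.prod_add, Finset.powerset_univ, Finset.mul_sum]
  rw [Finset.sum_comm]
  refine Finset.sum_congr rfl fun A _ => ?_
  rw [Finset.prod_mul_distrib (s := A), Finset.prod_pow_eq_pow_sum, ← hcard,
    ← sum_bernoulliWeight_disjoint, Finset.mul_sum, Finset.sum_mul]
  refine Finset.sum_congr rfl fun S _ => ?_
  rw [Finset.prod_mul_distrib (s := A), hdis]
  ring

/-! ### Exponential moments -/

theorem one_sub_exp_neg_ge {z : ℝ} (hz : 0 ≤ z) : z / (1 + z) ≤ 1 - Real.exp (-z) := by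
  have h : Real.exp (-z) ≤ 1 / (1 + z) := by
    rw [Real.exp_neg, ← one_div]
    exact one_div_le_one_div_of_le (by linarith) (by linarith [Real.add_one_le_exp z])
  have : z / (1 + z) = 1 - 1 / (1 + z) := by field_simp; ring
  linarith

theorem mix_exp_le {q y : ℝ} (hq : 0 ≤ q) (hy : |y| ≤ 1) :
    (1 - q) + q * Real.exp y ≤ Real.exp (q * (y + y ^ 2)) := by
  have h1 := (abs_le.mp (Real.abs_exp_sub_one_sub_id_le hy)).2
  have h2 := Real.add_one_le_exp (q * (y + y ^ 2))
  nlinarith [mul_le_mul_of_nonneg_left h1 hq]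

/-- The moment of one value `j` with parameter `1/8`. The linear term is kept exact because it
cancels on summing over `j`; `19/128 = 1/8 + (3/2)/64` collects the bias of `q` and the second-order
term of the exponential. -/
theorem exp_moment_upper {s v : ℝ} (hs : 0 ≤ s) (hv : |v| ≤ 1 / 2) :
    Real.exp (-(s * (1 + v))) + (1 - Real.exp (-(s * (1 + v)))) * Real.exp (v / 8) ≤
      Real.exp ((1 - Real.exp (-s)) * v / 8 + 19 / 128 * s * v ^ 2) := by
  obtain ⟨hv1, hv2⟩ := abs_le.mp hv
  set q := 1 - Real.exp (-(s * (1 + v))) with hq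
  have hq0 : 0 ≤ q := by
    have : Real.exp (-(s * (1 + v))) ≤ 1 := Real.exp_le_one_iff.mpr (by nlinarith)
    linarith
  have hqs : q ≤ 3 / 2 * s := by
    have := Real.add_one_le_exp (-(s * (1 + v)))
    nlinarith
  have h := mix_exp_le hq0 (y := v / 8) (by rw [abs_le]; constructor <;> linarith)
  have e : Real.exp (-(s * (1 + v))) = 1 - q := by rw [hq]; ring
  rw [e]
  refine h.trans (Real.exp_le_exp.mpr ?_)
  have hmul : Real.exp (-(s * (1 + v))) = Real.exp (-s) * Real.exp (-(s * v)) := by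
    rw [← Real.exp_add]; ring_nf
  -- The detection probability `1 - exp(-s(1+v))` is `s`-Lipschitz in `v ≥ -1`; the two signs of `v`
  -- need different factorizations of the difference.
  have key : (q - (1 - Real.exp (-s))) * v ≤ s * v ^ 2 := by
    have hb := Real.add_one_le_exp (-(s * v))
    have hb' := Real.add_one_le_exp (s * v)
    have hm : Real.exp (-(s * v)) * Real.exp (s * v) = 1 := by rw [← Real.exp_add]; simp
    have hes : Real.exp (-s) ≤ 1 := Real.exp_le_one_iff.mpr (by linarith)
    have hes0 := Real.exp_pos (-s)
    have hqe : q - (1 - Real.exp (-s)) = Real.exp (-s) * (1 - Real.exp (-(s * v))) := by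
      rw [hq, hmul]; ring
    rcases le_total 0 v with h0 | h0
    · have h1 : q - (1 - Real.exp (-s)) ≤ s * v := by
        rw [hqe]
        have : 0 ≤ s * v := mul_nonneg hs h0
        nlinarith
      nlinarith
    · have h1 : s * v ≤ q - (1 - Real.exp (-s)) := by
        have hE : Real.exp (-(s * (1 + v))) ≤ 1 := by linarith
        have : q - (1 - Real.exp (-s)) = Real.exp (-(s * (1 + v))) * (Real.exp (s * v) - 1) := by
          rw [hqe, hmul]
          linear_combination -(Real.exp (-s)) * hm
        rw [this]
        have h3 : Real.exp (s * v) - 1 ≤ 0 := by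
          have : Real.exp (s * v) ≤ 1 :=
            Real.exp_le_one_iff.mpr (mul_nonpos_of_nonneg_of_nonpos hs h0)
          linarith
        nlinarith
      nlinarith
  have h4 : q * v ^ 2 ≤ 3 / 2 * s * v ^ 2 := mul_le_mul_of_nonneg_right hqs (sq_nonneg v)
  nlinarith

/-- Far from uniform, `v` has no useful upper bound, so a quadratic gain is claimed only for `v ≤
0`, with `13/128 = (15/16)/8 - 1/64`. For `v ≥ 0` it suffices to recover the linear term. -/
theorem exp_moment_lower {s v : ℝ} (hs : 0 < s) (hs' : s ≤ 1 / 16) (hv : -1 ≤ v) :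
    Real.exp (-(s * (1 + v))) + (1 - Real.exp (-(s * (1 + v)))) * Real.exp (-(v / 8)) ≤
      Real.exp (-((1 - Real.exp (-s)) * v / 8) - 13 / 128 * s * (min v 0) ^ 2) := by
  set q := 1 - Real.exp (-(s * (1 + v))) with hq
  have e : Real.exp (-(s * (1 + v))) = 1 - q := by rw [hq]; ring
  have hE1 : Real.exp (-(s * (1 + v))) ≤ 1 := Real.exp_le_one_iff.mpr (by nlinarith)
  have hq0 : 0 ≤ q := by linarith
  have hq1 : q ≤ 1 := by linarith [Real.exp_pos (-(s * (1 + v)))]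
  have hes : 15 / 16 ≤ Real.exp (-s) := by linarith [Real.add_one_le_exp (-s)]
  have hq0s : 1 - Real.exp (-s) ≤ s := by linarith [Real.add_one_le_exp (-s)]
  have hmul : Real.exp (-(s * (1 + v))) = Real.exp (-s) * Real.exp (-(s * v)) := by
    rw [← Real.exp_add]; ring_nf
  rcases le_total v 0 with h0 | h0
  · rw [min_eq_left h0]
    have h := mix_exp_le hq0 (y := -(v / 8)) (by rw [abs_le]; constructor <;> linarith)
    rw [e]
    refine h.trans (Real.exp_le_exp.mpr ?_)
    have hqs : q ≤ s := by
      have := Real.add_one_le_exp (-(s * (1 + v)))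
      nlinarith
    have h1 : 15 / 16 * (s * (-v)) ≤ (1 - Real.exp (-s)) - q := by
      have : (1 - Real.exp (-s)) - q = Real.exp (-s) * (Real.exp (-(s * v)) - 1) := by
        rw [hq, hmul]; ring
      rw [this]
      have h2 := Real.add_one_le_exp (-(s * v))
      have h3 : 0 ≤ s * (-v) := mul_nonneg hs.le (by linarith)
      nlinarith
    have h2 := mul_le_mul_of_nonneg_right h1 (show 0 ≤ -v by linarith)
    have h3 : q * v ^ 2 ≤ s * v ^ 2 := mul_le_mul_of_nonneg_right hqs (sq_nonneg v)
    nlinarith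
  · rw [min_eq_right h0]
    have hexp : Real.exp (-((1 - Real.exp (-s)) * v / 8) - 13 / 128 * s * (0 : ℝ) ^ 2) =
        Real.exp (-((1 - Real.exp (-s)) * v / 8)) := by congr 1; ring
    rw [hexp]
    -- For `sv ≤ 3`, detection is more likely than at `v = 0` by a factor of at least `1 + v/8`,
    -- which offsets the concavity of `1 - exp(-v/8)`. For `sv ≥ 3`, each of the two terms is at
    -- most half of `exp(-sv/8)`.
    rcases le_total (s * v) 3 with h3 | h3
    · refine le_trans ?_ (Real.add_one_le_exp _)
      have h1 := one_sub_exp_neg_ge (z := v / 8) (by linarith)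
      have h2 := one_sub_exp_neg_ge (z := s * v) (by positivity)
      have h4 : s * v / 4 ≤ s * v / (1 + s * v) :=
        div_le_div_of_nonneg_left (by positivity) (by positivity) (by linarith)
      have hqq : v / 8 * (1 - Real.exp (-s)) ≤ q - (1 - Real.exp (-s)) := by
        have : q - (1 - Real.exp (-s)) = Real.exp (-s) * (1 - Real.exp (-(s * v))) := by
          rw [hq, hmul]; ring
        rw [this]
        have h5 : s * v / 4 ≤ 1 - Real.exp (-(s * v)) := by linarith
        have h6 : 0 ≤ s * v / 4 := by positivity
        nlinarith
      have h7 : (1 - Real.exp (-s)) * (v / 8) ≤ q * (1 - Real.exp (-(v / 8))) := by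
        calc (1 - Real.exp (-s)) * (v / 8)
            = ((1 + v / 8) * (1 - Real.exp (-s))) * (v / 8 / (1 + v / 8)) := by field_simp
          _ ≤ q * (v / 8 / (1 + v / 8)) :=
              mul_le_mul_of_nonneg_right (by linarith) (by positivity)
          _ ≤ _ := mul_le_mul_of_nonneg_left h1 hq0
      rw [e]
      linarith
    · have hv48 : 48 ≤ v := by nlinarith
      have hT : Real.exp (-(s * v / 8)) ≤ Real.exp (-((1 - Real.exp (-s)) * v / 8)) := by
        apply Real.exp_le_exp.mpr
        nlinarith
      have half : ∀ z : ℝ, 1 ≤ z → Real.exp (-z) ≤ 1 / 2 := by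
        intro z hz
        have := one_sub_exp_neg_ge (z := z) (by linarith)
        have h2 : 1 / 2 ≤ z / (1 + z) := by
          rw [div_le_div_iff₀ (by norm_num) (by linarith)]; linarith
        linarith
      have hA : Real.exp (-(s * (1 + v))) ≤ Real.exp (-(s * v / 8)) * (1 / 2) := by
        have : -(s * (1 + v)) = -(s * v / 8) + -(7 / 8 * (s * v) + s) := by ring
        rw [this, Real.exp_add]
        exact mul_le_mul_of_nonneg_left (half _ (by linarith)) (Real.exp_pos _).le
      have hB : Real.exp (-(v / 8)) ≤ Real.exp (-(s * v / 8)) * (1 / 2) := by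
        have : -(v / 8) = -(s * v / 8) + -((1 - s) * v / 8) := by ring
        rw [this, Real.exp_add]
        exact mul_le_mul_of_nonneg_left (half _ (by nlinarith)) (Real.exp_pos _).le
      have hC : q * Real.exp (-(v / 8)) ≤ Real.exp (-(v / 8)) :=
        mul_le_of_le_one_left (Real.exp_pos _).le hq1
      linarith

/-- Markov's inequality for the exponential moment with parameter `1/8`; independence turns the
moment into a product, and the linear terms cancel by `hsum`. -/
theorem tail_upper {p s : ℝ} (hp0 : 0 ≤ p) (hp1 : p ≤ 1) (hs : 0 ≤ s) (g : X → Y) (u : Y → ℝ)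
    (hu : ∀ j, (1 - p) ^ (Finset.univ.filter fun x => g x = j).card = Real.exp (-(s * u j)))
    (hsum : ∑ j, (u j - 1) = 0) (hbound : ∀ j, |u j - 1| ≤ 1 / 2) (l : ℝ) :
    ∑ S, bernoulliWeight p S * (if l ≤ ∑ j ∈ S.image g, (u j - 1) then 1 else 0) ≤
      Real.exp (19 / 128 * s * ∑ j, (u j - 1) ^ 2 - l / 8) := by
  have h1 := sum_bernoulliWeight_image p g (fun j => Real.exp ((u j - 1) / 8))
  have h2 : ∑ S, bernoulliWeight p S * ∏ j ∈ S.image g, Real.exp ((u j - 1) / 8) ≤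
      Real.exp (19 / 128 * s * ∑ j, (u j - 1) ^ 2) := by
    rw [h1]
    calc _ ≤ ∏ j, Real.exp ((1 - Real.exp (-s)) * (u j - 1) / 8 + 19 / 128 * s * (u j - 1) ^ 2) := by
          refine Finset.prod_le_prod (fun j _ => ?_) fun j _ => ?_
          · have : (0 : ℝ) ≤ 1 - p := by linarith
            have h3 : (1 - p) ^ (Finset.univ.filter fun x => g x = j).card ≤ 1 :=
              pow_le_one₀ this (by linarith)
            have : 0 ≤ 1 - (1 - p) ^ (Finset.univ.filter fun x => g x = j).card := by linarith
            positivity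
          · rw [hu]
            have := exp_moment_upper hs (hbound j)
            rwa [add_sub_cancel] at this
      _ = _ := by
          rw [← Real.exp_sum, Finset.sum_add_distrib, ← Finset.sum_div, ← Finset.mul_sum, hsum,
            ← Finset.mul_sum]
          ring_nf
  rw [sub_eq_add_neg, Real.exp_add]
  refine le_trans ?_ (mul_le_mul_of_nonneg_right h2 (Real.exp_pos _).le)
  rw [Finset.sum_mul]
  refine Finset.sum_le_sum fun S _ => ?_
  rw [mul_assoc]
  refine mul_le_mul_of_nonneg_left ?_ (bernoulliWeight_nonneg hp0 hp1 S)
  rw [← Real.exp_sum, ← Real.exp_add]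
  split_ifs with h
  · rw [← Finset.sum_div]
    exact Real.one_le_exp (by linarith)
  · exact (Real.exp_pos _).le

/-- The same argument with parameter `-1/8`; only values below the uniform density contribute to the
gain. -/
theorem tail_lower {p s : ℝ} (hp0 : 0 ≤ p) (hp1 : p ≤ 1) (hs : 0 < s) (hs' : s ≤ 1 / 16)
    (g : X → Y) (u : Y → ℝ)
    (hu : ∀ j, (1 - p) ^ (Finset.univ.filter fun x => g x = j).card = Real.exp (-(s * u j)))
    (hsum : ∑ j, (u j - 1) = 0) (hu0 : ∀ j, 0 ≤ u j) (l : ℝ) :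
    ∑ S, bernoulliWeight p S * (if ∑ j ∈ S.image g, (u j - 1) ≤ l then 1 else 0) ≤
      Real.exp (l / 8 - 13 / 128 * s * ∑ j, (min (u j - 1) 0) ^ 2) := by
  have h1 := sum_bernoulliWeight_image p g (fun j => Real.exp (-((u j - 1) / 8)))
  have h2 : ∑ S, bernoulliWeight p S * ∏ j ∈ S.image g, Real.exp (-((u j - 1) / 8)) ≤
      Real.exp (-(13 / 128 * s * ∑ j, (min (u j - 1) 0) ^ 2)) := by
    rw [h1]
    calc _ ≤ ∏ j, Real.exp (-((1 - Real.exp (-s)) * (u j - 1) / 8) -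
          13 / 128 * s * (min (u j - 1) 0) ^ 2) := by
          refine Finset.prod_le_prod (fun j _ => ?_) fun j _ => ?_
          · have : (0 : ℝ) ≤ 1 - p := by linarith
            have h3 : (1 - p) ^ (Finset.univ.filter fun x => g x = j).card ≤ 1 :=
              pow_le_one₀ this (by linarith)
            have : 0 ≤ 1 - (1 - p) ^ (Finset.univ.filter fun x => g x = j).card := by linarith
            positivity
          · rw [hu]
            have := exp_moment_lower hs hs' (v := u j - 1) (by linarith [hu0 j])
            rwa [add_sub_cancel] at this
      _ = _ := by
          rw [← Real.exp_sum, Finset.sum_sub_distrib, Finset.sum_neg_distrib, ← Finset.sum_div,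
            ← Finset.mul_sum, hsum, ← Finset.mul_sum]
          ring_nf
  rw [sub_eq_add_neg, Real.exp_add, mul_comm (Real.exp (l / 8))]
  refine le_trans ?_ (mul_le_mul_of_nonneg_right h2 (Real.exp_pos _).le)
  rw [Finset.sum_mul]
  refine Finset.sum_le_sum fun S _ => ?_
  rw [mul_assoc]
  refine mul_le_mul_of_nonneg_left ?_ (bernoulliWeight_nonneg hp0 hp1 S)
  rw [← Real.exp_sum, ← Real.exp_add]
  split_ifs with h
  · rw [Finset.sum_neg_distrib, ← Finset.sum_div]
    exact Real.one_le_exp (by linarith)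
  · exact (Real.exp_pos _).le

end Bernoulli

/-! ### The tester -/

section Tester

variable {n m R : ℕ}

/-- The values of `f` on a set of labelled points. -/
def labelledImage (f : Fin n → Fin m) (S : Finset (Fin n × Fin R)) : Finset (Fin m × Fin R) :=
  S.image fun q => (f q.1, q.2)

theorem Experiment.realizable_map {Ω Ω' : Type} (A : Experiment n m Ω) (d : Ω → Ω') :
    Realizable A.queries (fun f φ => A.expect f (fun ω => φ (d ω))) :=
  ⟨{ A with outcome := fun s => d (A.outcome s) }, rfl, fun _ _ => rfl⟩

/-- The expectation of a function whose value is `1` near the true value. -/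
theorem Experiment.one_sub_le_expect {A : Experiment n m ℝ} {f : Fin n → Fin m} {x V δ : ℝ}
    (hδ : 0 < δ) (hA : A.expect f (fun r => (r - x) ^ 2) ≤ V) {φ : ℝ → ℝ} (hφ : ∀ r, 0 ≤ φ r)
    (h : ∀ r, |r - x| < δ → φ r = 1) : 1 - V / δ ^ 2 ≤ A.expect f φ := by
  have h1 : A.expect f (fun r => 1 - 1 / δ ^ 2 * (r - x) ^ 2) ≤ A.expect f φ := by
    refine A.expect_mono f fun r => ?_
    by_cases hr : |r - x| < δ
    · rw [h r hr]
      have : 0 ≤ 1 / δ ^ 2 * (r - x) ^ 2 := by positivity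
      linarith
    · refine le_trans ?_ (hφ r)
      have h2 : δ ^ 2 ≤ (r - x) ^ 2 := by
        rw [← sq_abs (r - x)]
        exact pow_le_pow_left₀ hδ.le (not_lt.mp hr) 2
      rw [one_div, inv_mul_eq_div, sub_nonpos]
      exact (one_le_div (by positivity)).mpr h2
  rw [A.expect_const_sub_mul] at h1
  refine le_trans ?_ h1
  have := mul_le_mul_of_nonneg_left hA (show 0 ≤ 1 / δ ^ 2 by positivity)
  have e : V / δ ^ 2 = 1 / δ ^ 2 * V := by ring
  linarith

open Classical in
/-- The verdict from the estimate `r` of the square root of the marked fraction. -/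
noncomputable def decideVerdict (c r : ℝ) : Verdict :=
  if c ≤ r then Verdict.reject else Verdict.accept

-- The failure probability splits into too many samples (Markov), an atypical sample and a bad
-- estimate (Chebyshev). The predicate `bad` enters only the analysis, hence it is quantified after
-- the algorithm and may depend on `f`.
open Classical in
theorem exists_tester (hn : 0 < n) (hm : 0 < m) (hR : 0 < R) {L M : ℕ} (hL : 0 < L) (hM : 2 ≤ M)
    {p : ℝ} (hp0 : 0 ≤ p) (hp1 : p ≤ 1) (c : Finset (Fin m × Fin R) → ℝ) {δ : ℝ} (hδ : 0 < δ) :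
    ∃ Q : QueryAlgorithm n m, Q.queries = L + 2 * M ∧
      ∀ (f : Fin n → Fin m) (v : Verdict) (bad : Finset (Fin n × Fin R) → Prop),
        (∀ S : Finset (Fin n × Fin R), S.card ≤ L → ¬ bad S → ∀ r,
          |r - Real.sqrt (markedFraction (fun y i => (y, i) ∈ labelledImage f S) f)| < δ →
            decideVerdict (c (labelledImage f S)) r = v) →
        1 - p * (n * R) / L - ∑ S, bernoulliWeight p S * (if bad S then 1 else 0) -
          3 / (M : ℝ) ^ 2 / δ ^ 2 ≤ Q.outputProb f v := by
  choose A hAq hA using fun J : Finset (Fin m × Fin R) =>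
    exists_amplitudeEstimation (n := n) hn hm hR hM (fun y i => (y, i) ∈ J)
  have : Nonempty Verdict := ⟨Verdict.accept⟩
  have : Nonempty (Fin n → Fin m) := ⟨fun _ => ⟨0, hm⟩⟩
  -- Samples larger than `L` would exceed the query budget and get an arbitrary verdict.
  let E : Finset (Fin n × Fin R) → (Fin n → Fin m) → (Verdict → ℝ) → ℝ := fun S f φ =>
    if S.card ≤ L then
      (A (labelledImage f S)).expect f (fun r => φ (decideVerdict (c (labelledImage f S)) r))
    else φ Verdict.accept
  have hE : ∀ S, Realizable (L + 2 * M) (E S) := by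
    intro S
    by_cases hS : S.card ≤ L
    · have h1 := ((realizable_queries hn hm (S.image Prod.fst)).mono hn hm
        (Finset.card_image_le.trans hS)).bind (T' := 2 * M)
        (E' := fun h f φ => (A (labelledImage h S)).expect f
          (fun r => φ (decideVerdict (c (labelledImage h S)) r)))
        fun h => by
          have := (A (labelledImage h S)).realizable_map
            (decideVerdict (c (labelledImage h S)))
          rwa [hAq] at this
      convert h1 using 1
      funext f φ
      -- Labels are known for free: querying the first coordinates of `S` determines its labelled
      -- image, whatever the default value elsewhere.
      have h2 : labelledImage (fun x => if x ∈ S.image Prod.fst then f x else ⟨0, hm⟩) S =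
          labelledImage f S := by
        refine Finset.image_congr fun q hq => ?_
        have : q.1 ∈ S.image Prod.fst := Finset.mem_image_of_mem _ hq
        simp only [this, if_true]
      beta_reduce
      rw [h2]
      simp only [E, if_pos hS]
    · have h1 := realizable_idle (n := n) (m := m) hn hm Verdict.accept (L + 2 * M)
      convert h1 using 1
      funext f φ
      simp only [E, if_neg hS]
  obtain ⟨B, hBq, hB⟩ := (realizable_rand (m := m) hn (bernoulliWeight (X := Fin n × Fin R) p)
    (bernoulliWeight_nonneg hp0 hp1) (sum_bernoulliWeight p)).bind hE
  obtain ⟨Q, hQq, hQ⟩ := B.exists_queryAlgorithm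
  refine ⟨Q, by rw [hQq, hBq, zero_add], fun f v bad hgood => ?_⟩
  rw [hQ, hB]
  have hL' : (0 : ℝ) < L := by exact_mod_cast hL
  have hV : 0 ≤ 3 / (M : ℝ) ^ 2 / δ ^ 2 := by positivity
  have hpoint : ∀ S, 1 - (S.card : ℝ) / L - (if bad S then 1 else 0) - 3 / (M : ℝ) ^ 2 / δ ^ 2 ≤
      E S f (fun w => if w = v then 1 else 0) := by
    intro S
    have hSL : 0 ≤ (S.card : ℝ) / L := by positivity
    by_cases hS : S.card ≤ L
    · simp only [E, if_pos hS]
      by_cases hb : bad S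
      · have h0 : 0 ≤ (A (labelledImage f S)).expect f (fun r =>
            if decideVerdict (c (labelledImage f S)) r = v then 1 else 0) := by
          have h := (A (labelledImage f S)).expect_mono f (φ := fun _ => 0) (φ' := fun r =>
            if decideVerdict (c (labelledImage f S)) r = v then 1 else 0)
            (fun r => by split_ifs <;> norm_num)
          rwa [Experiment.expect_const] at h
        rw [if_pos hb]
        linarith
      · rw [if_neg hb]
        have := Experiment.one_sub_le_expect hδ (hA (labelledImage f S) f)
          (φ := fun r => if decideVerdict (c (labelledImage f S)) r = v then 1 else 0)
          (fun r => by split_ifs <;> norm_num)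
          (fun r hr => if_pos (hgood S hS hb r hr))
        linarith
    · have h1 : 1 ≤ (S.card : ℝ) / L := by
        rw [one_le_div hL']
        exact_mod_cast (not_le.mp hS).le
      have h2 : (0 : ℝ) ≤ if bad S then 1 else 0 := by split_ifs <;> norm_num
      have h3 : 0 ≤ E S f (fun w => if w = v then 1 else 0) := by
        simp only [E, if_neg hS]
        split_ifs <;> norm_num
      linarith
  calc _ = ∑ S : Finset (Fin n × Fin R), bernoulliWeight p S *
        (1 - (S.card : ℝ) / L - (if bad S then 1 else 0) - 3 / (M : ℝ) ^ 2 / δ ^ 2) := by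
        simp only [mul_sub, Finset.sum_sub_distrib]
        rw [← Finset.sum_mul, ← Finset.sum_mul, sum_bernoulliWeight, one_mul, one_mul]
        simp only [← mul_div_assoc]
        rw [← Finset.sum_div, sum_bernoulliWeight_mul_card]
        simp [mul_div_assoc]
    _ ≤ _ := Finset.sum_le_sum fun S _ =>
        mul_le_mul_of_nonneg_left (hpoint S) (bernoulliWeight_nonneg hp0 hp1 S)

end Tester

/-! ### The two hypotheses -/

section Distance

variable {n m : ℕ}

theorem sum_funDist (hn : 0 < n) (f : Fin n → Fin m) : ∑ j, funDist f j = 1 := by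
  have hn' : (n : ℝ) ≠ 0 := by exact_mod_cast hn.ne'
  have h := Finset.card_eq_sum_card_fiberwise (s := (Finset.univ : Finset (Fin n)))
    (t := (Finset.univ : Finset (Fin m))) (f := f) (fun _ _ => Finset.mem_coe.mpr (Finset.mem_univ _))
  rw [Finset.card_univ, Fintype.card_fin] at h
  simp only [funDist]
  rw [← Finset.sum_div, ← Nat.cast_sum, ← h, div_self hn']

theorem funDist_nonneg (f : Fin n → Fin m) (j : Fin m) : 0 ≤ funDist f j := by
  unfold funDist; positivity

theorem l1Dist_le_two (hn : 0 < n) (hm : 0 < m) (f : Fin n → Fin m) :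
    l1Dist (funDist f) (unifDist m) ≤ 2 := by
  have hm' : (m : ℝ) ≠ 0 := by exact_mod_cast hm.ne'
  calc l1Dist (funDist f) (unifDist m) ≤ ∑ j, (funDist f j + unifDist m j) := by
        refine Finset.sum_le_sum fun j _ => ?_
        have h1 := funDist_nonneg f j
        have h2 : 0 ≤ unifDist m j := by unfold unifDist; positivity
        rw [abs_le]; constructor <;> linarith
    _ = 2 := by
        rw [Finset.sum_add_distrib, sum_funDist hn]
        simp [unifDist, hm']
        norm_num

/-- The density of `P_f` with respect to the uniform distribution, on labelled values. -/
noncomputable def density {R : ℕ} (f : Fin n → Fin m) (j : Fin m × Fin R) : ℝ :=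
  m * funDist f j.1

theorem density_sub_one {R : ℕ} (hm : 0 < m) (f : Fin n → Fin m) (j : Fin m × Fin R) :
    density f j - 1 = m * (funDist f j.1 - unifDist m j.1) := by
  have hm' : (m : ℝ) ≠ 0 := by exact_mod_cast hm.ne'
  rw [density, unifDist]
  field_simp

theorem sum_labelled {R : ℕ} (F : Fin m → ℝ) :
    ∑ j : Fin m × Fin R, F j.1 = R * ∑ y, F y := by
  rw [Fintype.sum_prod_type, Finset.mul_sum]
  simp

theorem sum_density_sub_one {R : ℕ} (hn : 0 < n) (hm : 0 < m) (f : Fin n → Fin m) :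
    ∑ j : Fin m × Fin R, (density f j - 1) = 0 := by
  have hm' : (m : ℝ) ≠ 0 := by exact_mod_cast hm.ne'
  have h := sum_labelled (R := R) (fun y => (m : ℝ) * funDist f y - 1)
  refine h.trans ?_
  rw [Finset.sum_sub_distrib, ← Finset.mul_sum, sum_funDist hn]
  simp

theorem sum_abs_density_sub_one {R : ℕ} (hm : 0 < m) (f : Fin n → Fin m) :
    ∑ j : Fin m × Fin R, |density f j - 1| =
      m * R * l1Dist (funDist f) (unifDist m) := by
  simp only [density_sub_one hm, abs_mul, Nat.abs_cast]
  rw [← Finset.mul_sum, sum_labelled (R := R) (fun y => |funDist f y - unifDist m y|), l1Dist]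
  ring

/-- As the deviations sum to zero, the negative ones make up half of the `L₁`-norm; then apply
Cauchy–Schwarz. -/
theorem sum_min_density_sq_ge {R : ℕ} (hn : 0 < n) (hm : 0 < m) (hR : 0 < R) (f : Fin n → Fin m)
    {ε : ℝ} (hε : 0 ≤ ε) (h : ε ≤ l1Dist (funDist f) (unifDist m)) :
    m * R * ε ^ 2 / 4 ≤ ∑ j : Fin m × Fin R, (min (density f j - 1) 0) ^ 2 := by
  have hm' : (0 : ℝ) < m := by exact_mod_cast hm
  have hR' : (0 : ℝ) < R := by exact_mod_cast hR
  have h1 : ∑ j : Fin m × Fin R, min (density f j - 1) 0 =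
      -(m * R * l1Dist (funDist f) (unifDist m)) / 2 := by
    have hmin : ∀ j : Fin m × Fin R, min (density f j - 1) 0 =
        ((density f j - 1) - |density f j - 1|) / 2 := by
      intro j
      rcases le_total (density f j - 1) 0 with h | h
      · rw [min_eq_left h, abs_of_nonpos h]; ring
      · rw [min_eq_right h, abs_of_nonneg h]; ring
    simp only [hmin]
    rw [← Finset.sum_div, Finset.sum_sub_distrib, sum_density_sub_one hn hm,
      sum_abs_density_sub_one hm, zero_sub]
  have h2 := sq_sum_le_card_mul_sum_sq (s := (Finset.univ : Finset (Fin m × Fin R)))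
    (f := fun j => min (density f j - 1) 0)
  rw [h1, Finset.card_univ, Fintype.card_prod, Fintype.card_fin, Fintype.card_fin] at h2
  push_cast at h2
  have h3 : ε ^ 2 ≤ l1Dist (funDist f) (unifDist m) ^ 2 := pow_le_pow_left₀ hε h 2
  have h4 : (m * R : ℝ) * (m * R * ε ^ 2 / 4) ≤
      (m * R : ℝ) * ∑ j : Fin m × Fin R, (min (density f j - 1) 0) ^ 2 := by
    refine le_trans ?_ h2
    have := mul_le_mul_of_nonneg_left h3 (show (0 : ℝ) ≤ (m * R) ^ 2 / 4 by positivity)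
    linarith
  exact le_of_mul_le_mul_left h4 (by positivity)

theorem abs_density_sub_one_le {R : ℕ} (hm : 0 < m) (f : Fin n → Fin m) {ε : ℝ}
    (h : linftyDist (funDist f) (unifDist m) ≤ ε / (4 * (m : ℝ))) (j : Fin m × Fin R) :
    |density f j - 1| ≤ ε / 4 := by
  have hm' : (0 : ℝ) < m := by exact_mod_cast hm
  have h1 := (norm_le_pi_norm (funDist f - unifDist m) j.1).trans h
  rw [Pi.sub_apply, Real.norm_eq_abs] at h1
  rw [density_sub_one hm, abs_mul, Nat.abs_cast]
  calc (m : ℝ) * |funDist f j.1 - unifDist m j.1| ≤ m * (ε / (4 * m)) :=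
        mul_le_mul_of_nonneg_left h1 hm'.le
    _ = ε / 4 := by field_simp

theorem card_fiber_labelled {R : ℕ} (f : Fin n → Fin m) (j : Fin m × Fin R) :
    (Finset.univ.filter fun q : Fin n × Fin R => (f q.1, q.2) = j).card =
      (Finset.univ.filter fun x => f x = j.1).card := by
  have : (Finset.univ.filter fun q : Fin n × Fin R => (f q.1, q.2) = j) =
      (Finset.univ.filter fun x => f x = j.1) ×ˢ {j.2} := by
    ext q
    simp [Prod.ext_iff, eq_comm]
  rw [this, Finset.card_product, Finset.card_singleton, mul_one]

theorem markedFraction_eq {R : ℕ} (hn : 0 < n) (hm : 0 < m) (hR : 0 < R) (f : Fin n → Fin m)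
    (J : Finset (Fin m × Fin R)) :
    markedFraction (fun y i => (y, i) ∈ J) f =
      (J.card + ∑ j ∈ J, (density f j - 1)) / (m * R) := by
  have hn' : (n : ℝ) ≠ 0 := by exact_mod_cast hn.ne'
  have hm' : (m : ℝ) ≠ 0 := by exact_mod_cast hm.ne'
  have hR' : (R : ℝ) ≠ 0 := by exact_mod_cast hR.ne'
  have hden : ∑ j ∈ J, (density f j - 1) =
      m / n * ∑ j ∈ J, ((Finset.univ.filter fun x => f x = j.1).card : ℝ) - J.card := by
    rw [Finset.sum_sub_distrib, Finset.sum_const, nsmul_eq_mul, mul_one, Finset.mul_sum]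
    congr 1
    refine Finset.sum_congr rfl fun j _ => ?_
    rw [density, funDist]
    ring
  unfold markedFraction
  rw [Finset.card_eq_sum_card_fiberwise (f := fun p : Fin n × Fin R => (f p.1, p.2)) (t := J)
    (fun p hp => by simpa using hp), hden, Nat.cast_sum]
  have h : ∀ j ∈ J, (Finset.filter (fun p : Fin n × Fin R => (f p.1, p.2) = j)
      (@Finset.filter _ (fun p : Fin n × Fin R => (f p.1, p.2) ∈ J)
        (fun _ => Classical.propDecidable _) Finset.univ)).card =
      (Finset.univ.filter fun x => f x = j.1).card := by
    intro j hj
    rw [← card_fiber_labelled, Finset.filter_filter]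
    congr 1
    ext p
    simp only [Finset.mem_filter, Finset.mem_univ, true_and]
    exact ⟨fun h => h.2, fun h => ⟨h ▸ hj, h⟩⟩
  rw [Finset.sum_congr rfl fun j hj => congrArg (Nat.cast (R := ℝ)) (h j hj)]
  field_simp
  ring

end Distance

/-! ### Choice of parameters and the final count of queries. -/

/-- Use `√y - √x = (y - x)/(√y + √x)` with denominator at most `10√s`. -/
theorem sqrt_add_le_sqrt {x y s ε : ℝ} (hs : 0 < s) (h : x + ε ^ 2 * s / 32 ≤ y)
    (hx : 0 ≤ x) (hy : y ≤ 25 * s) :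
    Real.sqrt x + ε ^ 2 * Real.sqrt s / 320 ≤ Real.sqrt y := by
  have hpos : 0 ≤ ε ^ 2 * s / 32 := by positivity
  have hxy : Real.sqrt x ≤ Real.sqrt y := Real.sqrt_le_sqrt (by linarith)
  have hy5 : Real.sqrt y ≤ 5 * Real.sqrt s := by
    rw [show (5 : ℝ) = Real.sqrt 25 by rw [show (25 : ℝ) = 5 ^ 2 by norm_num]; simp,
      ← Real.sqrt_mul (by norm_num)]
    exact Real.sqrt_le_sqrt hy
  have hs0 := Real.sqrt_pos.mpr hs
  have hss := Real.sq_sqrt hs.le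
  have hsx := Real.sq_sqrt hx
  have hsy := Real.sq_sqrt (show 0 ≤ y by linarith)
  have hx0 := Real.sqrt_nonneg x
  have h1 : ε ^ 2 * Real.sqrt s ^ 2 / 32 ≤
      (Real.sqrt y - Real.sqrt x) * (Real.sqrt y + Real.sqrt x) := by
    rw [hss]; nlinarith
  have h2 : (Real.sqrt y - Real.sqrt x) * (Real.sqrt y + Real.sqrt x) ≤
      (Real.sqrt y - Real.sqrt x) * (10 * Real.sqrt s) :=
    mul_le_mul_of_nonneg_left (by linarith) (by linarith)
  have h3 : (ε ^ 2 * Real.sqrt s / 320) * (10 * Real.sqrt s) ≤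
      (Real.sqrt y - Real.sqrt x) * (10 * Real.sqrt s) := by linarith
  have := le_of_mul_le_mul_right h3 (by positivity)
  linarith

/-- Testing succeeds if `t` points are expected to be sampled and `s` is the expected number of
samples per labelled value. -/
theorem exists_uniformityTester {n m R : ℕ} (hn : 0 < n) (hm : 0 < m) (hR : 0 < R) {ε t s : ℝ}
    (hε : 0 < ε) (hε2 : ε ≤ 2) (ht : s * (m * R) = t) (hs : 0 < s) (hs' : s ≤ 1 / 16)
    (htε : 2048 ≤ t * ε ^ 2) {L M : ℕ} (hL : 20 * t ≤ L) (hL' : (L : ℝ) ≤ 21 * t) (hM : 2 ≤ M)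
    (hMs : 2560 / (ε ^ 2 * Real.sqrt s) ≤ M) :
    ∃ Q : QueryAlgorithm n m, Q.queries = L + 2 * M ∧ ∀ f : Fin n → Fin m,
      (ε ≤ l1Dist (funDist f) (unifDist m) → 2 / 3 ≤ Q.outputProb f Verdict.reject) ∧
      (linftyDist (funDist f) (unifDist m) ≤ ε / (4 * (m : ℝ)) →
        2 / 3 ≤ Q.outputProb f Verdict.accept) := by
  have hn' : (0 : ℝ) < n := by exact_mod_cast hn
  have hm' : (0 : ℝ) < m := by exact_mod_cast hm
  have hR' : (0 : ℝ) < R := by exact_mod_cast hR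
  have ht0 : 0 < t := by rw [← ht]; positivity
  have hε4 : ε ^ 2 ≤ 4 := by nlinarith
  have htε4 : t * ε ^ 2 ≤ 4 * t := by nlinarith
  have hL0 : (0 : ℝ) < L := by linarith
  set δ := ε ^ 2 * Real.sqrt s / 320 with hδ
  have hss : 0 < Real.sqrt s := Real.sqrt_pos.mpr hs
  have hδ0 : 0 < δ := by positivity
  -- With this `p`, a fibre of size `n·P_f(y)` is missed with probability exactly
  -- `exp(-s·m·P_f(y))`, so no Poisson approximation is needed.
  set p := 1 - Real.exp (-(s * m / n)) with hp
  have hp0 : 0 ≤ p := by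
    have : Real.exp (-(s * m / n)) ≤ 1 := Real.exp_le_one_iff.mpr (by
      have : 0 ≤ s * m / n := by positivity
      linarith)
    linarith
  have hp1 : p ≤ 1 := by linarith [Real.exp_pos (-(s * m / n))]
  let c : Finset (Fin m × Fin R) → ℝ := fun J =>
    Real.sqrt ((J.card + t * ε ^ 2 / 8) / (m * R))
  obtain ⟨Q, hQ, hprob⟩ := exists_tester hn hm hR (by exact_mod_cast hL0) hM hp0 hp1 c hδ0
  refine ⟨Q, hQ, fun f => ?_⟩
  have hsize : p * (n * R) / L ≤ 1 / 20 := by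
    have h1 : p ≤ s * m / n := by linarith [Real.add_one_le_exp (-(s * m / n))]
    have h2 : p * (n * R) ≤ t := by
      calc p * (n * R) ≤ s * m / n * (n * R) := mul_le_mul_of_nonneg_right h1 (by positivity)
        _ = t := by rw [← ht]; field_simp
    rw [div_le_div_iff₀ hL0 (by norm_num)]
    linarith
  -- The hypothesis on `M` says `Mδ ≥ 8`, and `3/64 ≤ 1/20`.
  have hest : 3 / (M : ℝ) ^ 2 / δ ^ 2 ≤ 1 / 20 := by
    have h1 : 8 ≤ M * δ := by
      have : 2560 / (ε ^ 2 * Real.sqrt s) * δ = 8 := by rw [hδ]; field_simp; norm_num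
      rw [← this]
      exact mul_le_mul_of_nonneg_right hMs hδ0.le
    have h2 : (64 : ℝ) ≤ (M : ℝ) ^ 2 * δ ^ 2 := by
      rw [← mul_pow]
      nlinarith
    rw [div_div, div_le_div_iff₀ (by linarith) (by norm_num)]
    linarith
  have hu : ∀ j : Fin m × Fin R,
      (1 - p) ^ (Finset.univ.filter fun q : Fin n × Fin R => (f q.1, q.2) = j).card =
        Real.exp (-(s * density f j)) := by
    intro j
    rw [card_fiber_labelled, hp, sub_sub_cancel, ← Real.exp_nat_mul, density, funDist]
    congr 1
    ring
  have hcardJ : ∀ S : Finset (Fin n × Fin R), S.card ≤ L →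
      ((labelledImage f S).card : ℝ) ≤ 21 * t := fun S hS => by
    have : (labelledImage f S).card ≤ L := Finset.card_image_le.trans hS
    exact le_trans (by exact_mod_cast this) hL'
  have hγ : ε ^ 2 * s / 32 = t * ε ^ 2 / 32 / (m * R) := by
    rw [← ht]; field_simp
  have hmR0 : (0 : ℝ) < m * R := by positivity
  constructor
  · intro hfar
    have hgood := hprob f Verdict.reject
      (fun S => ∑ j ∈ labelledImage f S, (density f j - 1) ≤ 10 / 64 * (t * ε ^ 2)) (by
        intro S hS hb r hr
        rw [markedFraction_eq hn hm hR] at hr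
        have hb' := not_le.mp hb
        have h1 := sqrt_add_le_sqrt (ε := ε) hs
          (x := ((labelledImage f S).card + t * ε ^ 2 / 8) / (m * R))
          (y := ((labelledImage f S).card + 10 / 64 * (t * ε ^ 2)) / (m * R))
          (by rw [hγ, ← add_div]; apply div_le_div_of_nonneg_right _ hmR0.le; linarith)
          (div_nonneg (add_nonneg (Nat.cast_nonneg _) (by positivity)) hmR0.le)
          (by
            rw [div_le_iff₀ hmR0, mul_assoc, ht]
            linarith [hcardJ S hS])
        have h2 : Real.sqrt (((labelledImage f S).card + 10 / 64 * (t * ε ^ 2)) / (m * R)) ≤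
            Real.sqrt (((labelledImage f S).card +
              ∑ j ∈ labelledImage f S, (density f j - 1)) / (m * R)) := by
          apply Real.sqrt_le_sqrt
          apply div_le_div_of_nonneg_right _ hmR0.le
          linarith
        have h3 := (abs_lt.mp hr).1
        refine if_pos ?_
        change Real.sqrt _ ≤ r
        linarith)
    have htail := tail_lower hp0 hp1 hs hs' (fun q : Fin n × Fin R => (f q.1, q.2)) (density f) hu
      (sum_density_sub_one hn hm f)
      (fun j => mul_nonneg hm'.le (funDist_nonneg f j.1)) (10 / 64 * (t * ε ^ 2))
    have hq := sum_min_density_sq_ge hn hm hR f hε.le hfar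
    -- In units of `tε²/512` the exponent is at most `10 - 13 = -3`, and `tε² ≥ 2048`. The failure
    -- probabilities add up to `1/20 + 1/13 + 1/20 < 1/3`.
    have hexp : 10 / 64 * (t * ε ^ 2) / 8 -
        13 / 128 * s * ∑ j : Fin m × Fin R, (min (density f j - 1) 0) ^ 2 ≤ -12 := by
      have h1 := mul_le_mul_of_nonneg_left hq hs.le
      have h2 : s * (m * R * ε ^ 2 / 4) = t * ε ^ 2 / 4 := by rw [← ht]; ring
      rw [h2] at h1
      linarith
    have h12 : Real.exp (-12) ≤ 1 / 13 := by
      linarith [one_sub_exp_neg_ge (z := 12) (by norm_num)]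
    have htail' := htail.trans ((Real.exp_le_exp.mpr hexp).trans h12)
    refine le_trans ?_ hgood
    have e : ∑ S : Finset (Fin n × Fin R), bernoulliWeight p S *
        (@ite ℝ (∑ j ∈ labelledImage f S, (density f j - 1) ≤ 10 / 64 * (t * ε ^ 2))
          (Classical.propDecidable _) 1 0) ≤ 1 / 13 := by
      refine le_trans (le_of_eq (Finset.sum_congr rfl fun S _ => ?_)) htail'
      exact congrArg _ (if_congr Iff.rfl rfl rfl)
    linarith
  · intro hnear
    have hd := abs_density_sub_one_le (R := R) hm f hnear
    have hgood := hprob f Verdict.accept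
      (fun S => 6 / 64 * (t * ε ^ 2) ≤ ∑ j ∈ labelledImage f S, (density f j - 1)) (by
        intro S hS hb r hr
        have hb' := not_le.mp hb
        have hnn := markedFraction_nonneg (fun y i => (y, i) ∈ labelledImage f S) f
        rw [markedFraction_eq hn hm hR] at hr hnn
        have h1 := sqrt_add_le_sqrt (ε := ε) hs
          (x := ((labelledImage f S).card +
              ∑ j ∈ labelledImage f S, (density f j - 1)) / (m * R))
          (y := ((labelledImage f S).card + t * ε ^ 2 / 8) / (m * R))
          (by rw [hγ, ← add_div]; apply div_le_div_of_nonneg_right _ hmR0.le; linarith)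
          hnn
          (by
            rw [div_le_iff₀ hmR0, mul_assoc, ht]
            linarith [hcardJ S hS])
        have h3 := (abs_lt.mp hr).2
        refine if_neg ?_
        change ¬ Real.sqrt _ ≤ r
        linarith)
    have htail := tail_upper hp0 hp1 hs.le (fun q : Fin n × Fin R => (f q.1, q.2)) (density f) hu
      (sum_density_sub_one hn hm f) (fun j => (hd j).trans (by linarith))
      (6 / 64 * (t * ε ^ 2))
    have hq : ∑ j : Fin m × Fin R, (density f j - 1) ^ 2 ≤ m * R * (ε ^ 2 / 16) := by
      calc _ ≤ ∑ j : Fin m × Fin R, ε ^ 2 / 16 := by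
            refine Finset.sum_le_sum fun j _ => ?_
            have := pow_le_pow_left₀ (abs_nonneg _) (hd j) 2
            rw [sq_abs] at this
            linarith
        _ = _ := by simp
    -- In units of `tε²/2048` the exponent is at most `19 - 24 = -5`. The failure probabilities add
    -- up to `1/20 + 1/6 + 1/20 < 1/3`.
    have hexp : 19 / 128 * s * ∑ j : Fin m × Fin R, (density f j - 1) ^ 2 -
        6 / 64 * (t * ε ^ 2) / 8 ≤ -5 := by
      have h1 := mul_le_mul_of_nonneg_left hq hs.le
      have h2 : s * (m * R * (ε ^ 2 / 16)) = t * ε ^ 2 / 16 := by rw [← ht]; ring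
      rw [h2] at h1
      linarith
    have h5 : Real.exp (-5) ≤ 1 / 6 := by
      linarith [one_sub_exp_neg_ge (z := 5) (by norm_num)]
    have htail' := htail.trans ((Real.exp_le_exp.mpr hexp).trans h5)
    refine le_trans ?_ hgood
    have e : ∑ S : Finset (Fin n × Fin R), bernoulliWeight p S *
        (@ite ℝ (6 / 64 * (t * ε ^ 2) ≤ ∑ j ∈ labelledImage f S, (density f j - 1))
          (Classical.propDecidable _) 1 0) ≤ 1 / 6 := by
      refine le_trans (le_of_eq (Finset.sum_congr rfl fun S _ => ?_)) htail'
      exact congrArg _ (if_congr Iff.rfl rfl rfl)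
    linarith

theorem exists_queryAlgorithm_accept {n m : ℕ} (hn : 0 < n) :
    ∃ Q : QueryAlgorithm n m, Q.queries = 0 ∧
      ∀ f : Fin n → Fin m, Q.outputProb f Verdict.accept = 1 := by
  obtain ⟨A, hA, hE⟩ := realizable_pure (n := n) (m := m) hn Verdict.accept
  obtain ⟨Q, hQ, hp⟩ := A.exists_queryAlgorithm
  exact ⟨Q, hQ.trans hA, fun f => by rw [hp, hE]; simp⟩

/-- Tolerant quantum uniformity tester with `O(m^{1/3} / ε²)` queries; the constant is absolute,
and the algorithm depends on `n`, `m`, `ε` but not on `f`. -/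
theorem mainTheorem3 :
    ∃ C : ℝ, 0 < C ∧
      ∀ (n m : ℕ) (ε : ℝ), 0 < n → 0 < m → 0 < ε →
        ∃ A : QueryAlgorithm n m,
          (A.queries : ℝ) ≤ C * ((m : ℝ) ^ (1 / 3 : ℝ) / ε ^ 2) ∧
          ∀ f : Fin n → Fin m,
            (ε ≤ l1Dist (funDist f) (unifDist m) →
              2 / 3 ≤ A.outputProb f Verdict.reject) ∧
            (linftyDist (funDist f) (unifDist m) ≤ ε / (4 * (m : ℝ)) →
              2 / 3 ≤ A.outputProb f Verdict.accept) := by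
  refine ⟨70000, by norm_num, fun n m ε hn hm hε => ?_⟩
  have hm' : (1 : ℝ) ≤ m := by exact_mod_cast hm
  set q := (m : ℝ) ^ (1 / 3 : ℝ) with hq
  have hq1 : 1 ≤ q := Real.one_le_rpow hm' (by norm_num)
  have hq3 : q ^ 3 = m := by
    rw [hq, ← Real.rpow_natCast, ← Real.rpow_mul (by positivity)]
    norm_num
  -- No distribution is at `L₁`-distance more than `2` from uniform, so for `ε > 2` accepting
  -- without queries is correct.
  rcases lt_or_ge 2 ε with hε2 | hε2
  · obtain ⟨Q, hQ, hp⟩ := exists_queryAlgorithm_accept (m := m) hn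
    refine ⟨Q, by rw [hQ]; simp only [Nat.cast_zero]; positivity, fun f => ⟨fun h => ?_, fun _ => ?_⟩⟩
    · exact absurd (h.trans (l1Dist_le_two hn hm f)) (not_le.mpr hε2)
    · rw [hp]; norm_num
  have hε4 : ε ^ 2 ≤ 4 := by nlinarith
  set w := q / ε ^ 2 with hw
  have hwε : w * ε ^ 2 = q := by rw [hw]; field_simp
  have hw4 : 1 / 4 ≤ w := by
    rw [hw, div_le_div_iff₀ (by norm_num) (by positivity)]
    linarith
  set t := 2048 * w with ht
  have ht0 : 0 < t := by linarith
  -- The least number of labels with `s = t/(mR) ≤ 1/16`; more than one label is needed when `16t >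
  -- m`.
  set R := ⌈16 * t / m⌉₊ with hR
  have hRpos : 0 < R := Nat.ceil_pos.mpr (by positivity)
  have hR' : (0 : ℝ) < R := by exact_mod_cast hRpos
  have hR1 : 16 * t ≤ m * R := by
    have := Nat.le_ceil (16 * t / m)
    rw [div_le_iff₀ (by positivity)] at this
    linarith
  have hR2 : m * R ≤ 16 * t + m := by
    have := (Nat.ceil_lt_add_one (show 0 ≤ 16 * t / m by positivity)).le
    have h := mul_le_mul_of_nonneg_left this (show (0 : ℝ) ≤ m by positivity)
    rwa [mul_add, mul_div_cancel₀ _ (by positivity), mul_one] at h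
  set s := t / (m * R) with hs
  have hmR0 : (0 : ℝ) < m * R := by positivity
  have hs0 : 0 < s := by positivity
  have hs16 : s ≤ 1 / 16 := by
    rw [hs, div_le_div_iff₀ hmR0 (by norm_num)]
    linarith
  have hss0 : 0 < Real.sqrt s := Real.sqrt_pos.mpr hs0
  -- From `mR ≤ 16t + m` and `m = q³ ≤ q²t` one gets `s ≥ 1/(17q²)`; the constant `25` is a
  -- convenient square above `17`.
  have hsq : 1 ≤ 5 * q * Real.sqrt s := by
    have h1 : m * R ≤ 17 * q ^ 2 * t := by
      have h2 : (m : ℝ) ≤ q ^ 2 * t := by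
        rw [← hq3, ht]
        have : q ≤ 4 * w := by nlinarith
        nlinarith [sq_nonneg q]
      nlinarith
    have h2 : 1 ≤ 25 * q ^ 2 * s := by
      rw [hs, mul_div_assoc', le_div_iff₀ hmR0]
      have : 0 ≤ q ^ 2 * t := by positivity
      linarith
    have h3 : (1 : ℝ) ^ 2 ≤ (5 * q * Real.sqrt s) ^ 2 := by
      rw [mul_pow, Real.sq_sqrt hs0.le]; linarith
    exact (pow_le_pow_iff_left₀ (by norm_num) (by positivity) two_ne_zero).mp h3
  set B := 2560 / (ε ^ 2 * Real.sqrt s) with hB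
  have hB1 : B ≤ 12800 * w := by
    rw [hB, div_le_iff₀ (by positivity)]
    calc (2560 : ℝ) ≤ 2560 * (5 * q * Real.sqrt s) := by linarith
      _ = 12800 * w * (ε ^ 2 * Real.sqrt s) := by rw [← hwε]; ring
  have hB2 : 2 ≤ B := by
    rw [hB, le_div_iff₀ (by positivity)]
    have : Real.sqrt s ≤ 1 := Real.sqrt_le_one.mpr (by linarith)
    nlinarith
  obtain ⟨Q, hQ, hprob⟩ := exists_uniformityTester hn hm hRpos hε hε2
    (t := t) (s := s) (by rw [hs]; field_simp) hs0 hs16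
    (by rw [ht, mul_assoc, hwε]; linarith) (L := ⌈20 * t⌉₊) (M := ⌈B⌉₊) (Nat.le_ceil _)
    ((Nat.ceil_lt_add_one (by positivity)).le.trans (by linarith))
    (by
      have := hB2.trans (Nat.le_ceil B)
      exact_mod_cast this) (Nat.le_ceil _)
  refine ⟨Q, ?_, hprob⟩
  rw [hQ]
  push_cast
  -- The total is at most `20·2048w + 2·12800w + 3 = 66560w + 3`, and `3 ≤ 12w`, which fits under
  -- `70000w`.
  have h1 := (Nat.ceil_lt_add_one (show 0 ≤ 20 * t by positivity)).le
  have h2 := (Nat.ceil_lt_add_one (show 0 ≤ B by linarith)).le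
  linarith
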